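/- Let $x=(x_1,x_2,\dots)$ and $y=(y_1,y_2,\dots)$ be absolutely summable sequences of real numbers, or of complex numbers. For a strict partition $\lambda=(\lambda_1>\lambda_2>\dots>\lambda_\ell>0)$ let $Q_\lambda(x)=\sum_T x^T$ be Schur's $Q$-function, where $T$ runs over all shifted tableaux of shape $\lambda$: row $i$ of the shape has $\lambda_i$ boxes and is indented by $i-1$ boxes; the boxes are filled with letters of the ordered alphabet $1'<1<2'<2<\cdots$ so that rows and columns are weakly increasing, each marked letter $m'$ occurs at most once in every row, and each unmarked letter $m$ occurs at most once in every column; and $x^T=\prod_m x_m^{a_m}$, where $a_m$ is the number of boxes of $T$ that contain $m$ or $m'$. Let $P_\lambda=2^{-\ell(\lambda)}Q_\lambda$, and let $q_k(x)$ be defined by $$\prod_{i\ge1}\frac{1+t x_i}{1-t x_i}=\sum_{k\ge 0} q_k(x)\,t^k$$ as formal power series in $t$. For positive integers $r,s$ with $r>s$, $Q_{(r,s)}$ is the $Q$-function of the strict partition $(r,s)$, and $Q_{(r,s)}=-Q_{(s,r)}$ if $r\le s$ (so $Q_{(r,r)}=0$). For an integer $h\ge0$ let $K_h(x)$ be the antisymmetric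 $(h+1)\times(h+1)$ matrix with rows and columns indexed by $0,1,\dots,h$ and entries $$K_h(x)_{00}=0,\qquad K_h(x)_{0s}=-\tfrac1{\sqrt2}\,q_s(x),\qquad K_h(x)_{r0}=\tfrac1{\sqrt2}\,q_r(x),\qquad K_h(x)_{rs}=\tfrac12\,Q_{(r,s)}(x)\qquad(r,s\ge1).$$ Then the series defining the $Q_\lambda$ converge, the infinite products defining the $q_k$ converge coefficientwise, and for every $h\ge 0$ $$\sum_{\lambda\ \text{strict},\ \lambda_1\le h}Q_\lambda(x)\,P_\lambda(y)=\det\bigl(I-K_h(x)K_h(y)\bigr)^{1/2},$$ where the sum includes the empty partition. The square root is understood as follows: the square of the left-hand side equals the determinant; the left-hand side is the value at $z=1$ of a function $f(z)$, analytic for all real (respectively complex) $z$, with $f(0)=1$ and $f(z)^2=\det\bigl(I-K_h(zx)K_h(zy)\bigr)$ for all $z$; and if all $x_i\ge0$ and $y_i\ge 0$, the left-hand side is the nonnegative square root of the (real) determinant. -/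

import Mathlib

open scoped PowerSeries.WithPiTopology ComplexOrder

noncomputable section

/-- The ordered alphabet `1' < 1 < 2' < 2 < ⋯`. The letter `(m, false)` is the marked letter and
`(m, true)` the unmarked letter attached to the variable `x m` (variables are numbered from `0`);
the order is lexicographic, with `false < true`. -/
abbrev MarkedLetter : Type := ℕ ×ₗ Bool

namespace MarkedLetter

/-- The index of the variable of a letter, forgetting the mark. -/
def index (a : MarkedLetter) : ℕ := (ofLex a).1

/-- The letter carries a prime. -/
def IsMarked (a : MarkedLetter) : Prop := (ofLex a).2 = false

end MarkedLetter

/-- The boxes of the shifted shape with row lengths `rows = [λ₁, λ₂, …]`: the box `⟨i, j⟩` is the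
`j`-th box of row `i` (both counted from `0`). -/
abbrev ShiftedCell (rows : List ℕ) : Type := (i : Fin rows.length) × Fin (rows.get i)

/-- The column of a box: row `i` (counted from `0`) is indented by `i` boxes. -/
def ShiftedCell.col {rows : List ℕ} (c : ShiftedCell rows) : ℕ := (c.1 : ℕ) + (c.2 : ℕ)

/-- Generalized shifted Young tableaux of the shifted shape with row lengths `rows`: weakly
increasing along rows and down columns, with each marked letter at most once in every row and
each unmarked letter at most once in every column. -/
structure ShiftedTableau (rows : List ℕ) where
  entry : ShiftedCell rows → MarkedLetter
  row_weak : ∀ c d : ShiftedCell rows, c.1 = d.1 → c.col < d.col → entry c ≤ entry d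
  col_weak : ∀ c d : ShiftedCell rows, c.col = d.col → c.1 < d.1 → entry c ≤ entry d
  row_marked : ∀ c d : ShiftedCell rows, c.1 = d.1 → entry c = entry d →
    (entry c).IsMarked → c = d
  col_unmarked : ∀ c d : ShiftedCell rows, c.col = d.col → entry c = entry d →
    ¬ (entry c).IsMarked → c = d

/-- The monomial `x^T`. -/
def ShiftedTableau.weight {R : Type*} [CommMonoid R] {rows : List ℕ} (T : ShiftedTableau rows)
    (x : ℕ → R) : R :=
  ∏ c : ShiftedCell rows, x (T.entry c).index

variable {𝕜 : Type*} [RCLike 𝕜]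

/-- Schur's `Q`-function, the sum of `x^T` over all shifted tableaux of the given shape. -/
def schurQ (rows : List ℕ) (x : ℕ → 𝕜) : 𝕜 := ∑' T : ShiftedTableau rows, T.weight x

/-- Schur's `P`-function `P_λ = 2^{-ℓ(λ)} Q_λ`. -/
def schurP (rows : List ℕ) (x : ℕ → 𝕜) : 𝕜 := schurQ rows x / 2 ^ rows.length

/-- The factor `(1 + t x_i) / (1 - t x_i)`, as a formal power series in `t`. -/
def qFactor (x : ℕ → 𝕜) (i : ℕ) : PowerSeries 𝕜 :=
  (1 + PowerSeries.C (x i) * PowerSeries.X) * (1 - PowerSeries.C (x i) * PowerSeries.X)⁻¹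

/-- `q_k(x)`, the coefficient of `t^k` in `∏_i (1 + t x_i) / (1 - t x_i)`; the product converges
coefficientwise. -/
def qFun (k : ℕ) (x : ℕ → 𝕜) : 𝕜 := PowerSeries.coeff k (∏' i, qFactor x i)

/-- `Q_{(r,s)}` for all positive integers `r, s`: the `Q`-function of the strict partition `(r,s)`
if `r > s`, extended antisymmetrically. -/
def schurQPair (r s : ℕ) (x : ℕ → 𝕜) : 𝕜 :=
  if s < r then schurQ [r, s] x else if r < s then - schurQ [s, r] x else 0

/-- The antisymmetric matrix `K_h(x)`, with rows and columns numbered `0, …, h`. -/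
def gesselK (h : ℕ) (x : ℕ → 𝕜) : Matrix (Fin (h + 1)) (Fin (h + 1)) 𝕜 :=
  Matrix.of fun r s =>
    if r = 0 then
      if s = 0 then 0 else -(1 / ((√2 : ℝ) : 𝕜)) * qFun (s : ℕ) x
    else
      if s = 0 then (1 / ((√2 : ℝ) : 𝕜)) * qFun (r : ℕ) x
      else (1 / 2) * schurQPair (r : ℕ) (s : ℕ) x

/-- The strict partitions with largest part at most `h`, each given by its set of parts; the empty
partition is included. -/
def strictPartitions (h : ℕ) : Finset (Finset ℕ) := (Finset.Icc 1 h).powerset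

/-- The parts of a strict partition in decreasing order. -/
def partsDesc (p : Finset ℕ) : List ℕ := p.sort (· ≥ ·)

/-- The sum of `Q_λ(x) P_λ(y)` over the strict partitions `λ` with `λ₁ ≤ h`. -/
def gesselSum (h : ℕ) (x y : ℕ → 𝕜) : 𝕜 :=
  ∑ p ∈ strictPartitions h, schurQ (partsDesc p) x * schurP (partsDesc p) y

end

/-! ### Pfaffians as Gaussian functionals on the exterior algebra. -/

section Wick

open ExteriorAlgebra

variable {R M : Type*} [CommRing R] [AddCommGroup M] [Module R M]

local infixl:70 "⌋" => CliffordAlgebra.contractLeft (R := R) (M := M) (Q := 0)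

/-! The proof has two independent halves, both using Pfaffians through a fermionic Gaussian
functional: the linear functional `wick A` on the exterior algebra with value `1` at `1` and Wick's
rule `wick A (m ∧ x) = wick A (A m ⌋ x)`. On a product of vectors it is the Pfaffian of their Gram
matrix.

Linear algebra: for alternating forms `A`, `B` and vectors `E i`, `F i`, put `A ⊕ (-B)` on the
direct sum. Expanding the product of the factors `1 + E i ∧ F i` gives the sum over `S` of `Pf (A_S)
Pf (B_S)`, where the sign of `-B` cancels the sign from reordering the factors. On the other hand,
multiplying a Gaussian functional by `1 + e ∧ f` gives a multiple of another Gaussian functional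
with an explicit rank-two change of covariance (`wick_pair_mul`). Removing the factors one at a time
shows that the square of the expectation is a determinant (`wick_prod_pairs_sq`), which for the
direct sum is `det (1 - G_A G_B)` (`sum_wick_mul_wick_sq`).

Combinatorics: Schur's Pfaffian formula for `Q_λ` (`schurQ_eq_limitWick`). For finitely many letters
it is proved by removing the largest letter. This acts on the rows by one linear operator, with the
overlaps cancelling in the wedge product (`ιMulti_letterVec_eq_sum`), so the generating function
with one more letter is the old functional at transformed vectors. The case of two rows identifies
the new Gram matrix, and with it all Pfaffians. Letting the number of letters tend to infinity gives
the formula for `Q_λ`. The one-row case also identifies `q_r` with the row function `Q_(r)`.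

Finally, the index `0` of `K_h` serves as an empty row that makes the number of rows even. For each
strict partition `p` exactly one of `p` and `p ∪ {0}` has even size, and the factors `1/√2` of the
two Pfaffians combine to `2^{-ℓ}`, turning `Q Q` into `Q P`. The assertions on the branch of the
root follow from homogeneity and positivity of the `Q_λ`. -/

theorem neg_toQuadraticMap_eq {A : LinearMap.BilinForm R M} (hA : A.IsAlt) :
    (-A).toQuadraticMap = (0 : QuadraticForm R M) - 0 := by
  ext m
  simp [hA m]

/-- The Gaussian functional of an alternating form `A` on the exterior algebra: on a product of
vectors it is the Pfaffian of their Gram matrix. -/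
def wick (A : LinearMap.BilinForm R M) (hA : A.IsAlt) : ExteriorAlgebra R M →ₗ[R] R :=
  (ExteriorAlgebra.algebraMapInv (R := R) (M := M)).toLinearMap ∘ₗ
    CliffordAlgebra.changeForm (neg_toQuadraticMap_eq hA)

theorem wick_one (A : LinearMap.BilinForm R M) (hA : A.IsAlt) : wick A hA 1 = 1 := by
  simp only [wick, LinearMap.comp_apply, AlgHom.toLinearMap_apply]
  erw [CliffordAlgebra.changeForm_one]
  simp

/-- Since `A` is alternating, `changeForm` along `-A` deforms the exterior algebra into itself. It
turns multiplication by `m` into multiplication by `m` plus contraction with `A m`; the projection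
to scalars kills the first summand, and the contraction commutes with `changeForm`. -/
theorem wick_ι_mul (A : LinearMap.BilinForm R M) (hA : A.IsAlt) (m : M)
    (x : ExteriorAlgebra R M) : wick A hA (ι R m * x) = wick A hA (A m⌋x) := by
  simp only [wick, LinearMap.comp_apply, AlgHom.toLinearMap_apply]
  erw [CliffordAlgebra.changeForm_ι_mul, CliffordAlgebra.changeForm_contractLeft]
  have h : algebraMapInv (R := R) (ι R m) = 0 := by simp [algebraMapInv]
  rw [map_sub]
  erw [map_mul, h]
  simp

theorem contractLeft_ι_mul' (d : Module.Dual R M) (m : M) (x : ExteriorAlgebra R M) :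
    d⌋(ι R m * x) = d m • x - ι R m * (d⌋x) :=
  CliffordAlgebra.contractLeft_ι_mul d m x

theorem ιMulti_cons (n : ℕ) (m : M) (v : Fin n → M) :
    ιMulti R (n + 1) (Fin.cons m v) = ι R m * ιMulti R n v := by
  rw [ιMulti_succ_apply]; rfl

theorem ιMulti_succ_tail (n : ℕ) (v : Fin (n + 1) → M) :
    ιMulti R (n + 1) v = ι R (v 0) * ιMulti R n (Fin.tail v) := by
  rw [ιMulti_succ_apply]; rfl

/-- The graded Leibniz rule for the contraction of a product of vectors. -/
theorem contractLeft_ιMulti_mul (d : Module.Dual R M) (n : ℕ) (v : Fin (n + 1) → M)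
    (y : ExteriorAlgebra R M) :
    d⌋(ιMulti R (n + 1) v * y) =
      ∑ j : Fin (n + 1), ((-1) ^ (j : ℕ) * d (v j)) • (ιMulti R n (fun i => v (j.succAbove i)) * y)
        + (-1 : R) ^ (n + 1) • (ιMulti R (n + 1) v * (d⌋y)) := by
  induction n with
  | zero =>
    rw [ιMulti_succ_tail, mul_assoc, contractLeft_ι_mul']
    simp [sub_eq_add_neg]
  | succ n ih =>
    rw [ιMulti_succ_tail, mul_assoc, contractLeft_ι_mul', ih, Fin.sum_univ_succ (n := n + 1)]
    have h1 : ∀ j : Fin (n + 1),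
        ιMulti R (n + 1) (fun i => v ((Fin.succ j).succAbove i)) =
          ι R (v 0) * ιMulti R n (fun i => Fin.tail v (j.succAbove i)) := by
      intro j
      rw [ιMulti_succ_tail]
      congr 2
      funext i
      simp [Fin.tail]
    simp only [h1, Fin.val_zero, pow_zero, one_mul, Fin.zero_succAbove, Fin.val_succ]
    have h2 : (fun i : Fin (n + 1) => v i.succ) = Fin.tail v := rfl
    rw [h2, mul_add, Finset.mul_sum, sub_add_eq_sub_sub, sub_eq_add_neg, sub_eq_add_neg,
      ← Finset.sum_neg_distrib]
    congr 1
    · congr 1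
      refine Finset.sum_congr rfl fun j _ => ?_
      rw [mul_smul_comm, ← neg_smul, mul_assoc, pow_succ]
      congr 1
      simp only [Fin.tail]
      ring
    · rw [mul_smul_comm, ← neg_smul, mul_assoc, pow_succ _ (n + 1)]
      congr 1
      ring

theorem contractLeft_ιMulti (d : Module.Dual R M) (n : ℕ) (v : Fin (n + 1) → M) :
    d⌋(ιMulti R (n + 1) v) =
      ∑ j : Fin (n + 1), ((-1) ^ (j : ℕ) * d (v j)) • ιMulti R n (fun i => v (j.succAbove i)) := by
  have h := contractLeft_ιMulti_mul d n v 1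
  simpa using h

/-- Expansion of a Pfaffian along its first row. -/
theorem wick_ιMulti_succ_succ (A : LinearMap.BilinForm R M) (hA : A.IsAlt) (n : ℕ)
    (v : Fin (n + 2) → M) :
    wick A hA (ιMulti R (n + 2) v) =
      ∑ j : Fin (n + 1), ((-1) ^ (j : ℕ) * A (v 0) (v j.succ)) *
        wick A hA (ιMulti R n (fun i => v (j.succAbove i).succ)) := by
  rw [ιMulti_succ_tail, wick_ι_mul, contractLeft_ιMulti, map_sum]
  simp [Fin.tail]

theorem wick_ιMulti_one (A : LinearMap.BilinForm R M) (hA : A.IsAlt) (v : Fin 1 → M) :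
    wick A hA (ιMulti R 1 v) = 0 := by
  rw [ιMulti_succ_tail, wick_ι_mul]
  simp

theorem wick_ιMulti_two (A : LinearMap.BilinForm R M) (hA : A.IsAlt) (v : Fin 2 → M) :
    wick A hA (ιMulti R 2 v) = A (v 0) (v 1) := by
  rw [wick_ιMulti_succ_succ]
  simp [wick_one]

theorem wick_ι_mul_ι (A : LinearMap.BilinForm R M) (hA : A.IsAlt) (a b : M) :
    wick A hA (ι R a * ι R b) = A a b := by
  simpa using wick_ιMulti_two A hA ![a, b]

theorem wick_ιMulti_odd (A : LinearMap.BilinForm R M) (hA : A.IsAlt) :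
    ∀ (n : ℕ) (_ : Odd n) (v : Fin n → M), wick A hA (ιMulti R n v) = 0
  | 0, h, _ => by simp at h
  | 1, _, v => wick_ιMulti_one A hA v
  | n + 2, h, v => by
    rw [wick_ιMulti_succ_succ]
    refine Finset.sum_eq_zero fun j _ => ?_
    rw [wick_ιMulti_odd A hA n (by simpa [parity_simps] using h), mul_zero]

/-- The Gaussian functional depends on the Gram matrix only. -/
theorem wick_ιMulti_congr {M' : Type*} [AddCommGroup M'] [Module R M']
    (A : LinearMap.BilinForm R M) (hA : A.IsAlt) (A' : LinearMap.BilinForm R M') (hA' : A'.IsAlt) :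
    ∀ (n : ℕ) (v : Fin n → M) (v' : Fin n → M')
      (_ : ∀ i j, i < j → A (v i) (v j) = A' (v' i) (v' j)),
      wick A hA (ιMulti R n v) = wick A' hA' (ιMulti R n v')
  | 0, _, _, _ => by simp [wick_one]
  | 1, v, v', _ => by rw [wick_ιMulti_one, wick_ιMulti_one]
  | n + 2, v, v', h => by
    rw [wick_ιMulti_succ_succ, wick_ιMulti_succ_succ]
    refine Finset.sum_congr rfl fun j _ => ?_
    rw [h 0 j.succ (Fin.succ_pos j)]
    congr 1
    refine wick_ιMulti_congr A hA A' hA' n _ _ fun a b hab => h _ _ ?_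
    exact Fin.succ_lt_succ_iff.2 (Fin.strictMono_succAbove j hab)

/-- Independence of orthogonal factors: in the Wick expansion no vector of `v` pairs with `y`, so
the recursion runs inside `v` only. -/
theorem wick_ιMulti_mul_of_orthogonal (A : LinearMap.BilinForm R M) (hA : A.IsAlt)
    (y : ExteriorAlgebra R M) :
    ∀ (n : ℕ) (v : Fin n → M) (_ : ∀ i, A (v i)⌋y = 0),
      wick A hA (ιMulti R n v * y) = wick A hA (ιMulti R n v) * wick A hA y
  | 0, v, _ => by simp [wick_one]
  | 1, v, h => by
    rw [wick_ιMulti_one, ιMulti_succ_tail, mul_assoc, wick_ι_mul]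
    simp [h]
  | n + 2, v, h => by
    rw [wick_ιMulti_succ_succ, ιMulti_succ_tail, mul_assoc, wick_ι_mul, contractLeft_ιMulti_mul,
      h, mul_zero, smul_zero, add_zero, map_sum, Finset.sum_mul]
    refine Finset.sum_congr rfl fun j _ => ?_
    rw [map_smul, smul_eq_mul, wick_ιMulti_mul_of_orthogonal A hA y n
      (fun i => Fin.tail v (j.succAbove i)) fun i => h _, mul_assoc,
      mul_assoc, mul_assoc]
    rfl

theorem span_ιMulti_eq_top :
    Submodule.span R (Set.range fun s : Σ n, Fin n → M => ιMulti R s.1 s.2) = ⊤ := by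
  rw [eq_top_iff]
  intro x _
  induction x using CliffordAlgebra.left_induction with
  | algebraMap r =>
    rw [Algebra.algebraMap_eq_smul_one]
    refine Submodule.smul_mem _ _ (Submodule.subset_span ⟨⟨0, Fin.elim0⟩, ?_⟩)
    simp
  | add x y hx hy => exact Submodule.add_mem _ (hx trivial) (hy trivial)
  | ι_mul x m hx =>
    have : Submodule.span R (Set.range fun s : Σ n, Fin n → M => ιMulti R s.1 s.2) ≤
        (Submodule.span R (Set.range fun s : Σ n, Fin n → M => ιMulti R s.1 s.2)).comap
          (LinearMap.mulLeft R (ι R m)) := by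
      rw [Submodule.span_le]
      rintro _ ⟨s, rfl⟩
      exact Submodule.subset_span ⟨⟨s.1 + 1, Fin.cons m s.2⟩, ιMulti_cons _ _ _⟩
    exact this (hx trivial)

theorem ext_ιMulti {N : Type*} [AddCommGroup N] [Module R N] {f g : ExteriorAlgebra R M →ₗ[R] N}
    (h : ∀ (n : ℕ) (v : Fin n → M), f (ιMulti R n v) = g (ιMulti R n v)) : f = g :=
  LinearMap.ext_on_range span_ιMulti_eq_top fun s => h s.1 s.2

/-- A functional satisfying Wick's rule is a multiple of the Gaussian functional. -/
theorem eq_smul_wick (A : LinearMap.BilinForm R M) (hA : A.IsAlt)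
    (f : ExteriorAlgebra R M →ₗ[R] R) (hf : ∀ m x, f (ι R m * x) = f (A m⌋x)) :
    f = f 1 • wick A hA := by
  have key : ∀ (n : ℕ) (v : Fin n → M), f (ιMulti R n v) = f 1 * wick A hA (ιMulti R n v) := by
    intro n
    induction n using Nat.strong_induction_on with
    | _ n ih =>
      intro v
      match n, ih, v with
      | 0, _, v => simp [wick_one]
      | 1, _, v =>
        rw [wick_ιMulti_one, ιMulti_succ_tail, hf]; simp
      | n + 2, ih, v =>
        rw [wick_ιMulti_succ_succ, ιMulti_succ_tail, hf, contractLeft_ιMulti, map_sum,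
          Finset.mul_sum]
        refine Finset.sum_congr rfl fun j _ => ?_
        rw [map_smul, smul_eq_mul, ih n (by omega)]
        simp only [Fin.tail]
        ring
  exact ext_ιMulti fun n v => by simpa using key n v

/-- A Pfaffian is a polynomial in the entries of the Gram matrix; the expansion along the first row
gives its continuity. -/
theorem tendsto_wick [TopologicalSpace R] [IsTopologicalRing R] {α : Type*} {F : Filter α}
    (A : α → LinearMap.BilinForm R M) (hA : ∀ p, (A p).IsAlt) (B : LinearMap.BilinForm R M)
    (hB : B.IsAlt) :
    ∀ (n : ℕ) (v : Fin n → M)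
      (_ : ∀ i j, Filter.Tendsto (fun p => A p (v i) (v j)) F (nhds (B (v i) (v j)))),
      Filter.Tendsto (fun p => wick (A p) (hA p) (ιMulti R n v)) F
        (nhds (wick B hB (ιMulti R n v)))
  | 0, _, _ => by simp [wick_one, tendsto_const_nhds]
  | 1, v, _ => by simp only [wick_ιMulti_one, tendsto_const_nhds]
  | n + 2, v, h => by
    simp only [wick_ιMulti_succ_succ]
    refine tendsto_finsetSum _ fun j _ => ?_
    exact ((h _ _).const_mul _).mul (tendsto_wick A hA B hB n _ fun a b => h _ _)

theorem tendsto_wick_apply [TopologicalSpace R] [IsTopologicalRing R] {α : Type*} {F : Filter α}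
    (A : α → LinearMap.BilinForm R M) (hA : ∀ p, (A p).IsAlt) (B : LinearMap.BilinForm R M)
    (hB : B.IsAlt) (h : ∀ m m', Filter.Tendsto (fun p => A p m m') F (nhds (B m m')))
    (x : ExteriorAlgebra R M) :
    Filter.Tendsto (fun p => wick (A p) (hA p) x) F (nhds (wick B hB x)) := by
  have hx : x ∈ Submodule.span R (Set.range fun s : Σ n, Fin n → M => ιMulti R s.1 s.2) := by
    rw [span_ιMulti_eq_top]; trivial
  induction hx using Submodule.span_induction with
  | mem x hx =>
    obtain ⟨s, rfl⟩ := hx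
    exact tendsto_wick A hA B hB _ _ fun i j => h _ _
  | zero => simp [tendsto_const_nhds]
  | add x y _ _ hx hy => simpa using hx.add hy
  | smul c x _ hx => simpa using hx.const_mul c

/-- Moving a vector past both factors changes the sign twice, so products of two vectors are
central. -/
theorem commute_ι_mul_ι (a b : M) (x : ExteriorAlgebra R M) :
    Commute (ι R a * ι R b) x := by
  induction x using CliffordAlgebra.left_induction with
  | algebraMap r => exact (Algebra.commutes r _).symm
  | add x y hx hy => exact hx.add_right hy
  | ι_mul x m hx =>
    refine Commute.mul_right ?_ hx
    have h1 : ι R a * ι R m = - (ι R m * ι R a) := eq_neg_of_add_eq_zero_left (ι_add_mul_swap a m)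
    have h2 : ι R b * ι R m = - (ι R m * ι R b) := eq_neg_of_add_eq_zero_left (ι_add_mul_swap b m)
    change ι R a * ι R b * ι R m = ι R m * (ι R a * ι R b)
    rw [mul_assoc, h2, mul_neg, ← mul_assoc, h1, neg_mul, neg_neg, mul_assoc]

end Wick

/-! ### Gaussian expectations of products of factors `1 + e f`. -/

section PairSum

open ExteriorAlgebra

variable {K M : Type*} [Field K] [AddCommGroup M] [Module K M]

local infixl:70 "⌋" => CliffordAlgebra.contractLeft (R := K) (M := M) (Q := 0)

/-- The covariance of the Gaussian functional of `C` conditioned by the factor `1 + e f`. -/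
def conditionedForm (C : LinearMap.BilinForm K M) (e f : M) : LinearMap.BilinForm K M :=
  C + (1 + C e f)⁻¹ • ((C.flip e).smulRight (C f) - (C.flip f).smulRight (C e))

theorem conditionedForm_apply (C : LinearMap.BilinForm K M) (e f m n : M) :
    conditionedForm C e f m n =
      C m n + (1 + C e f)⁻¹ * (C m e * C f n - C m f * C e n) := by
  simp [conditionedForm]

theorem conditionedForm_isAlt {C : LinearMap.BilinForm K M} (hC : C.IsAlt) (e f : M) :
    (conditionedForm C e f).IsAlt := by
  intro m
  rw [conditionedForm_apply, hC m, ← hC.neg_eq m e, ← hC.neg_eq m f]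
  ring

/-- The functional `x ↦ wick C ((1 + e f) x)` again satisfies Wick's rule, for the conditioned form;
by `eq_smul_wick` it is then a multiple of that Gaussian functional, the factor being its value `1 +
C e f` at `1`. -/
theorem wick_pair_mul {C : LinearMap.BilinForm K M} (hC : C.IsAlt) (e f : M) (h : 1 + C e f ≠ 0)
    (x : ExteriorAlgebra K M) :
    wick C hC ((1 + ι K e * ι K f) * x) =
      (1 + C e f) * wick (conditionedForm C e f) (conditionedForm_isAlt hC e f) x := by
  set w : ExteriorAlgebra K M := 1 + ι K e * ι K f with hw
  have hcomm : ∀ y, Commute w y := fun y => (Commute.one_left y).add_left (commute_ι_mul_ι e f y)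
  let Φ : ExteriorAlgebra K M →ₗ[K] K := wick C hC ∘ₗ LinearMap.mulLeft K w
  have hΦ : ∀ y, Φ y = wick C hC (w * y) := fun y => rfl
  have hee : ι K e * ι K e = 0 := ι_sq_zero e
  have hff : ι K f * ι K f = 0 := ι_sq_zero f
  have hef : ι K f * ι K e = - (ι K e * ι K f) := eq_neg_of_add_eq_zero_left (ι_add_mul_swap f e)
  have hwe : ∀ y, w * (ι K e * y) = ι K e * y := by
    intro y
    rw [hw, add_mul, one_mul, ← mul_assoc, mul_assoc (ι K e), hef, mul_neg, ← mul_assoc, hee]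
    simp
  have hwf : ∀ y, w * (ι K f * y) = ι K f * y := by
    intro y
    rw [hw, add_mul, one_mul, ← mul_assoc, mul_assoc (ι K e), hff]
    simp
  have hcon : ∀ (d : Module.Dual K M) (y : ExteriorAlgebra K M),
      d⌋(w * y) = w * (d⌋y) + (d e • (ι K f * y) - d f • (ι K e * y)) := by
    intro d y
    rw [hw, add_mul, one_mul, map_add, mul_assoc, contractLeft_ι_mul', contractLeft_ι_mul']
    rw [mul_sub, add_mul, one_mul, mul_smul_comm, mul_assoc]
    abel
  -- Contracting through `w = 1 + e f` leaves terms `f y` and `e y` without the factor `w`; it may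
  -- be reinserted because `w` acts on them as the identity.
  have step : ∀ m y, Φ (ι K m * y) = Φ (C m⌋y) + (C m e * Φ (ι K f * y) - C m f * Φ (ι K e * y)) := by
    intro m y
    rw [hΦ, hΦ, hΦ, hΦ, hwe, hwf, ← mul_assoc, (hcomm _).eq, mul_assoc, wick_ι_mul, hcon]
    simp
  have hfe : C f e = - C e f := by rw [← hC.neg_eq e f]
  -- For `m = e` the term `Φ (e y)` occurs on both sides of `step`, with total coefficient `1 + C e
  -- f`, so it can be solved for; the same works for `f`.
  have he : ∀ y, Φ (ι K e * y) = (1 + C e f)⁻¹ * Φ (C e⌋y) := by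
    intro y
    have h1 := step e y
    rw [hC e] at h1
    field_simp
    linear_combination h1
  have hf : ∀ y, Φ (ι K f * y) = (1 + C e f)⁻¹ * Φ (C f⌋y) := by
    intro y
    have h1 := step f y
    rw [hC f, hfe] at h1
    field_simp
    linear_combination h1
  have hrule : ∀ m y, Φ (ι K m * y) = Φ (conditionedForm C e f m⌋y) := by
    intro m y
    rw [step, he, hf]
    have : conditionedForm C e f m =
        C m + (1 + C e f)⁻¹ • (C m e • C f - C m f • C e) := by
      ext n; simp [conditionedForm]
    rw [this]
    simp only [map_add, map_sub, map_smul, LinearMap.add_apply, LinearMap.sub_apply,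
      LinearMap.smul_apply, smul_eq_mul]
    ring
  have h1 : Φ 1 = 1 + C e f := by
    rw [hΦ, mul_one, hw, map_add, wick_one, wick_ι_mul_ι]
  have := congrArg (fun g => g x) (eq_smul_wick _ (conditionedForm_isAlt hC e f) Φ hrule)
  simpa [h1, hΦ] using this

variable {J : Type*} [Fintype J] [DecidableEq J]

/-- The Gram matrix of a family of vectors. -/
def gramMatrix (C : LinearMap.BilinForm K M) (v : J → M) : Matrix J J K :=
  Matrix.of fun a b => C (v a) (v b)

/-- The elementary antisymmetric matrix with entry `1` at `(a, b)` and `-1` at `(b, a)`. -/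
def pairMatrix (K : Type*) {J : Type*} [Field K] [DecidableEq J] (p : J × J) : Matrix J J K :=
  Matrix.single p.1 p.2 1 - Matrix.single p.2 p.1 1

theorem gramMatrix_mul_pairMatrix_mul (G H : Matrix J J K) (a b m n : J) :
    (G * pairMatrix K (a, b) * H) m n = G m a * H b n - G m b * H a n := by
  simp only [pairMatrix, mul_sub, sub_mul, Matrix.sub_apply, Matrix.mul_apply, Matrix.single_apply]
  simp [ite_and]

/-- The perturbation has the form `U V` with inner dimension two, so the determinant equals that of
`1 - V U`, which is the scalar `1 + C (v a) (v b)` times the `2 × 2` identity. -/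
theorem det_one_sub_mul_pairMatrix (C : LinearMap.BilinForm K M) (hC : C.IsAlt) (v : J → M)
    (a b : J) :
    (1 - gramMatrix C v * pairMatrix K (a, b)).det = (1 + C (v a) (v b)) ^ 2 := by
  let U : Matrix J (Fin 2) K := Matrix.of fun m => ![C (v m) (v a), C (v m) (v b)]
  let V : Matrix (Fin 2) J K := Matrix.of ![Pi.single b 1, -Pi.single a 1]
  have hUV : gramMatrix C v * pairMatrix K (a, b) = U * V := by
    ext m n
    have := gramMatrix_mul_pairMatrix_mul (gramMatrix C v) 1 a b m n
    rw [mul_one] at this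
    rw [this]
    simp [U, V, Matrix.mul_apply, Fin.sum_univ_two, gramMatrix, Matrix.one_apply, Pi.single_apply,
      eq_comm, sub_eq_add_neg]
  have hVU : V * U = !![C (v b) (v a), C (v b) (v b); -C (v a) (v a), -C (v a) (v b)] := by
    ext i j
    fin_cases i <;> fin_cases j <;>
      simp [U, V, Matrix.mul_apply, Pi.single_apply]
  rw [hUV, Matrix.det_one_sub_mul_comm, hVU, hC, hC, ← hC.neg_eq (v a) (v b), Matrix.det_fin_two]
  simp
  ring

/-- With `P` the pair matrix, the Gram matrices `G` of `C` and `G'` of the conditioned form satisfy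
`G = (1 - G P) G'`. This is the matrix counterpart of `wick_pair_mul`. -/
theorem one_sub_gramMatrix_mul_add (C : LinearMap.BilinForm K M) (hC : C.IsAlt) (v : J → M)
    (a b : J) (h : 1 + C (v a) (v b) ≠ 0) (Z : Matrix J J K) :
    1 - gramMatrix C v * (pairMatrix K (a, b) + Z) =
      (1 - gramMatrix C v * pairMatrix K (a, b)) *
        (1 - gramMatrix (conditionedForm C (v a) (v b)) v * Z) := by
  have key : gramMatrix C v = (1 - gramMatrix C v * pairMatrix K (a, b)) *
      gramMatrix (conditionedForm C (v a) (v b)) v := by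
    ext m n
    rw [sub_mul, one_mul, Matrix.sub_apply, gramMatrix_mul_pairMatrix_mul]
    simp only [gramMatrix, Matrix.of_apply, conditionedForm_apply, hC (v a), hC (v b)]
    rw [← hC.neg_eq (v a) (v b)]
    field_simp
    ring
  rw [mul_add, mul_sub, mul_one, ← mul_assoc, ← key]
  abel

theorem continuous_det_one_sub {K : Type*} [RCLike K] (G Z : Matrix J J K) :
    Continuous fun t : K => (1 - (t • G) * Z).det := by
  refine Continuous.matrix_det ?_
  fun_prop

/-- The square of a Gaussian expectation of a product of factors `1 + e f` is a determinant. -/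
theorem wick_prod_pairs_sq {K M : Type*} [RCLike K] [AddCommGroup M] [Module K M]
    {J : Type*} [Fintype J] [DecidableEq J] (v : J → M) (l : List (J × J)) :
    ∀ (C : LinearMap.BilinForm K M) (hC : C.IsAlt),
      wick C hC (l.map fun p => 1 + ι K (v p.1) * ι K (v p.2)).prod ^ 2 =
        (1 - gramMatrix C v * (l.map (pairMatrix K)).sum).det := by
  induction l with
  | nil => intro C hC; simp [wick_one]
  | cons p l ih =>
    obtain ⟨a, b⟩ := p
    have generic : ∀ (C : LinearMap.BilinForm K M) (hC : C.IsAlt), 1 + C (v a) (v b) ≠ 0 →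
        wick C hC (((a, b) :: l).map fun p => 1 + ι K (v p.1) * ι K (v p.2)).prod ^ 2 =
          (1 - gramMatrix C v * (((a, b) :: l).map (pairMatrix K)).sum).det := by
      intro C hC h
      rw [List.map_cons, List.prod_cons, List.map_cons, List.sum_cons,
        one_sub_gramMatrix_mul_add C hC v a b h, Matrix.det_mul, wick_pair_mul hC _ _ h, mul_pow,
        ih, det_one_sub_mul_pairMatrix C hC]
    intro C hC
    -- In the degenerate case `C` is deformed to `t C`. Then `1 + t C (v a) (v b) = 1 - t` is
    -- nonzero for `t ≠ 1`, and both sides are continuous at `t = 1`.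
    by_cases h : 1 + C (v a) (v b) = 0
    · have hCt : ∀ t : K, (t • C).IsAlt := fun t m => by simp [hC m]
      set x := (((a, b) :: l).map fun p => 1 + ι K (v p.1) * ι K (v p.2)).prod
      set Z := (((a, b) :: l).map (pairMatrix K)).sum
      have t1 : Filter.Tendsto (fun t : K => wick (t • C) (hCt t) x ^ 2) (nhdsWithin 1 {1}ᶜ)
          (nhds (wick C hC x ^ 2)) := by
        refine Filter.Tendsto.pow (tendsto_wick_apply _ _ _ _ (fun m m' => ?_) x) 2
        have : Continuous fun t : K => (t • C) m m' := by
          simp only [LinearMap.smul_apply, smul_eq_mul]; fun_prop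
        refine (this.tendsto' 1 _ (by simp)).mono_left nhdsWithin_le_nhds
      have t2 : Filter.Tendsto (fun t : K => wick (t • C) (hCt t) x ^ 2) (nhdsWithin 1 {1}ᶜ)
          (nhds ((1 - gramMatrix C v * Z).det)) := by
        have hc := (continuous_det_one_sub (gramMatrix C v) Z).tendsto' 1
          ((1 - gramMatrix C v * Z).det) (by simp)
        refine (hc.mono_left nhdsWithin_le_nhds).congr' ?_
        filter_upwards [self_mem_nhdsWithin] with t ht
        rw [generic (t • C) (hCt t)]
        · rfl
        · have hc' : C (v a) (v b) = -1 := by linear_combination h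
          rw [LinearMap.smul_apply, LinearMap.smul_apply, hc']
          simp only [smul_eq_mul, mul_neg, mul_one]
          rw [← sub_eq_add_neg, sub_ne_zero]
          exact fun h => ht h.symm
      exact tendsto_nhds_unique t1 t2
    · exact generic C hC h

end PairSum

/-! ### Sums over subsets of products of two sub-Pfaffians. -/

section SubsetSum

open ExteriorAlgebra

variable {R M : Type*} [CommRing R] [AddCommGroup M] [Module R M]

local infixl:70 "⌋" => CliffordAlgebra.contractLeft (R := R) (M := M) (Q := 0)

/-- The product of a list of vectors in the exterior algebra. -/
def wedgeList (R : Type*) {M : Type*} [CommRing R] [AddCommGroup M] [Module R M] (l : List M) :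
    ExteriorAlgebra R M :=
  (l.map (ι R)).prod

theorem wedgeList_cons (m : M) (l : List M) : wedgeList R (m :: l) = ι R m * wedgeList R l := by
  simp [wedgeList]

theorem wedgeList_append (l l' : List M) :
    wedgeList R (l ++ l') = wedgeList R l * wedgeList R l' := by
  simp [wedgeList]

theorem wedgeList_ofFn {n : ℕ} (v : Fin n → M) : wedgeList R (List.ofFn v) = ιMulti R n v := by
  rw [wedgeList, List.map_ofFn, ιMulti_apply]; rfl

theorem wedgeList_eq_ιMulti (l : List M) :
    wedgeList R l = ιMulti R l.length (fun i => l.get i) := by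
  rw [← wedgeList_ofFn, List.ofFn_get]

theorem ι_mul_wedgeList (m : M) (l : List M) :
    ι R m * wedgeList R l = (-1 : R) ^ l.length • (wedgeList R l * ι R m) := by
  induction l with
  | nil => simp [wedgeList]
  | cons a l ih =>
    have h : ι R m * ι R a = - (ι R a * ι R m) := eq_neg_of_add_eq_zero_left (ι_add_mul_swap m a)
    rw [wedgeList_cons, ← mul_assoc, h, neg_mul, mul_assoc, ih, List.length_cons, pow_succ,
      mul_smul_comm, mul_assoc]
    simp

theorem wedgeList_reverse (l : List M) :
    wedgeList R l.reverse = (-1 : R) ^ (l.length.choose 2) • wedgeList R l := by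
  induction l with
  | nil => simp
  | cons a l ih =>
    have h1 : wedgeList R [a] = ι R a := by simp [wedgeList]
    have h2 : ((-1 : R) ^ l.length) * (-1) ^ l.length = 1 := by rw [← mul_pow]; simp
    rw [List.reverse_cons, wedgeList_append, ih, h1, wedgeList_cons, ι_mul_wedgeList,
      List.length_cons, Nat.choose_succ_succ' l.length 1, Nat.choose_one_right, smul_smul, pow_add,
      smul_mul_assoc,
      mul_right_comm, h2, one_mul]

theorem contractLeft_wedgeList_of_forall (d : Module.Dual R M) (l : List M) (h : ∀ m ∈ l, d m = 0) :
    d⌋(wedgeList R l) = 0 := by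
  induction l with
  | nil => simp [wedgeList]
  | cons a l ih =>
    rw [wedgeList_cons, contractLeft_ι_mul', h a (by simp), ih fun m hm => h m (by simp [hm])]
    simp

theorem wick_neg_ιMulti (A : LinearMap.BilinForm R M) (hA : A.IsAlt) (hA' : (-A).IsAlt) :
    ∀ (n : ℕ) (v : Fin n → M),
      (-1) ^ (n.choose 2) * wick (-A) hA' (ιMulti R n v) = wick A hA (ιMulti R n v)
  | 0, _ => by simp [wick_one]
  | 1, v => by simp only [wick_ιMulti_one, mul_zero]
  | n + 2, v => by
    rw [wick_ιMulti_succ_succ, wick_ιMulti_succ_succ, Finset.mul_sum]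
    refine Finset.sum_congr rfl fun j _ => ?_
    rw [← wick_neg_ιMulti A hA hA' n]
    have h : (n + 2).choose 2 = n.choose 2 + 2 * n + 1 := by
      rw [Nat.choose_succ_succ' (n + 1) 1, Nat.choose_succ_succ' n 1]
      simp; ring
    rw [h, pow_succ, pow_add, pow_mul]
    simp only [LinearMap.neg_apply]
    ring

/-- Reversing `n` vectors and negating the form each multiply the Pfaffian by `(-1) ^ (n.choose 2)`:
for `n = 2m` this sign is `(-1) ^ m`, and for odd `n` the value is zero. This is why `-B` is used in
`directSumForm`. -/
theorem wick_neg_wedgeList_reverse (A : LinearMap.BilinForm R M) (hA : A.IsAlt)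
    (hA' : (-A).IsAlt) (l : List M) :
    wick (-A) hA' (wedgeList R l.reverse) = wick A hA (wedgeList R l) := by
  rw [wedgeList_reverse, map_smul, smul_eq_mul, wedgeList_eq_ιMulti, wick_neg_ιMulti A hA hA']

theorem wick_wedgeList_map {M' I : Type*} [AddCommGroup M'] [Module R M']
    (A : LinearMap.BilinForm R M) (hA : A.IsAlt) (A' : LinearMap.BilinForm R M') (hA' : A'.IsAlt)
    (v : I → M) (v' : I → M') (h : ∀ i j, A (v i) (v j) = A' (v' i) (v' j)) (l : List I) :
    wick A hA (wedgeList R (l.map v)) = wick A' hA' (wedgeList R (l.map v')) := by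
  have h1 : ∀ {M : Type _} (w : I → M), l.map w = List.ofFn fun i => w (l.get i) := by
    intro M w
    conv_lhs => rw [← List.ofFn_get l, List.map_ofFn]
    rfl
  have h2 : ∀ {M : Type _} (w : I → M), l.map w = List.ofFn fun i => w (l.get i) := by
    intro M w
    conv_lhs => rw [← List.ofFn_get l, List.map_ofFn]
    rfl
  rw [h1, h2, wedgeList_ofFn, wedgeList_ofFn]
  exact wick_ιMulti_congr A hA A' hA' _ _ _ fun i j _ => h _ _

/-- Each pair is central, so the pairs can be nested inside one another without signs, which leaves
the second factors in reverse order. -/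
theorem prod_pairs_eq_wedgeList (a b : ℕ → M) (l : List ℕ) :
    (l.map fun i => ι R (a i) * ι R (b i)).prod =
      wedgeList R (l.map a) * wedgeList R (l.map b).reverse := by
  induction l with
  | nil => simp [wedgeList]
  | cons i l ih =>
    rw [List.map_cons, List.prod_cons, ih, List.map_cons, List.map_cons, wedgeList_cons,
      List.reverse_cons, wedgeList_append, ← mul_assoc (ι R (a i) * wedgeList R (l.map a)),
      mul_assoc (ι R (a i)) (wedgeList R (l.map a)), ← ih]
    have hc : Commute (l.map fun i => ι R (a i) * ι R (b i)).prod (ι R (b i)) := by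
      refine Commute.list_prod_left _ _ fun x hx => ?_
      obtain ⟨j, -, rfl⟩ := List.mem_map.1 hx
      exact commute_ι_mul_ι _ _ _
    have h1 : wedgeList R [b i] = ι R (b i) := by simp [wedgeList]
    rw [h1, mul_assoc, mul_assoc, hc.eq]

theorem prod_one_add_pairs (a b : ℕ → M) (n : ℕ) :
    ((List.range n).reverse.map fun i => 1 + ι R (a i) * ι R (b i)).prod =
      ∑ S ∈ (Finset.range n).powerset,
        ((S.sort (· ≥ ·)).map fun i => ι R (a i) * ι R (b i)).prod := by
  induction n with
  | zero => simp
  | succ n ih =>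
    rw [List.range_succ, List.reverse_append, Finset.range_add_one,
      Finset.sum_powerset_insert Finset.notMem_range_self, ← ih]
    simp only [List.reverse_singleton, List.singleton_append, List.map_cons, List.prod_cons]
    rw [add_mul, one_mul, ih, Finset.mul_sum]
    congr 1
    refine Finset.sum_congr rfl fun S hS => ?_
    have hS' : ∀ b ∈ S, b < n := fun b hb => Finset.mem_range.1 (Finset.mem_powerset.1 hS hb)
    rw [Finset.sort_insert (r := (· ≥ ·)) (fun b hb => (hS' b hb).le)
      fun h => lt_irrefl _ (hS' n h)]
    simp

/-- The orthogonal direct sum of `A` and `-B`. -/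
def directSumForm {M' : Type*} [AddCommGroup M'] [Module R M'] (A : LinearMap.BilinForm R M)
    (B : LinearMap.BilinForm R M') : LinearMap.BilinForm R (M × M') :=
  A.compl₁₂ (LinearMap.fst R M M') (LinearMap.fst R M M') -
    B.compl₁₂ (LinearMap.snd R M M') (LinearMap.snd R M M')

theorem directSumForm_apply {M' : Type*} [AddCommGroup M'] [Module R M']
    (A : LinearMap.BilinForm R M) (B : LinearMap.BilinForm R M') (p q : M × M') :
    directSumForm A B p q = A p.1 q.1 - B p.2 q.2 := by
  simp [directSumForm]

theorem directSumForm_isAlt {M' : Type*} [AddCommGroup M'] [Module R M']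
    {A : LinearMap.BilinForm R M} {B : LinearMap.BilinForm R M'} (hA : A.IsAlt) (hB : B.IsAlt) :
    (directSumForm A B).IsAlt := by
  intro p
  rw [directSumForm_apply, hA, hB, sub_zero]

/-- After the first and second components are separated, orthogonality splits the expectation into
two Pfaffians, and the reversal of the second list is absorbed by the sign of `-B`. -/
theorem wick_directSumForm {M' : Type*} [AddCommGroup M'] [Module R M']
    (A : LinearMap.BilinForm R M) (B : LinearMap.BilinForm R M') (hA : A.IsAlt) (hB : B.IsAlt)
    (E : ℕ → M) (F : ℕ → M') (l : List ℕ) :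
    wick (directSumForm A B) (directSumForm_isAlt hA hB)
      (l.map fun i => ι R ((E i, 0) : M × M') * ι R ((0, F i) : M × M')).prod =
      wick A hA (wedgeList R (l.map E)) * wick B hB (wedgeList R (l.map F)) := by
  have hB' : (-B).IsAlt := fun m => by simp [hB m]
  rw [prod_pairs_eq_wedgeList, wedgeList_eq_ιMulti (l.map _),
    wick_ιMulti_mul_of_orthogonal, ← wedgeList_eq_ιMulti, ← wick_neg_wedgeList_reverse B hB hB']
  · congr 1
    · exact wick_wedgeList_map _ _ _ _ _ _ (fun i j => by simp [directSumForm_apply]) l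
    · rw [← List.map_reverse, ← List.map_reverse]
      exact wick_wedgeList_map _ _ _ _ _ _ (fun i j => by simp [directSumForm_apply]) _
  · intro i
    refine contractLeft_wedgeList_of_forall _ _ fun m hm => ?_
    have hi : (l.map fun i => ((E i, 0) : M × M')).get i ∈ l.map fun i => ((E i, 0) : M × M') :=
      List.get_mem _ _
    obtain ⟨a, -, ha⟩ := List.mem_map.1 hi
    obtain ⟨b, -, rfl⟩ := List.mem_map.1 (List.mem_reverse.1 hm)
    rw [← ha, directSumForm_apply]
    simp

theorem sum_pairMatrix (K : Type*) [Field K] (n : ℕ) :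
    ((List.finRange n).reverse.map fun i => pairMatrix K
      ((Sum.inl i, Sum.inr i) : (Fin n ⊕ Fin n) × (Fin n ⊕ Fin n))).sum =
      Matrix.fromBlocks 0 1 (-1) 0 := by
  rw [(((List.reverse_perm _).map _)).sum_eq, ← List.sum_toFinset _ (List.nodup_finRange n),
    List.toFinset_finRange]
  ext i j
  rw [Matrix.sum_apply]
  rcases i with i | i <;> rcases j with j | j <;>
    simp [pairMatrix, Matrix.single_apply, Matrix.one_apply, ite_and]

/-- A sum of products of sub-Pfaffians squares to a determinant. -/
theorem sum_wick_mul_wick_sq {K M M' : Type*} [RCLike K] [AddCommGroup M] [Module K M]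
    [AddCommGroup M'] [Module K M'] (A : LinearMap.BilinForm K M) (B : LinearMap.BilinForm K M')
    (hA : A.IsAlt) (hB : B.IsAlt) (E : ℕ → M) (F : ℕ → M') (n : ℕ) :
    (∑ S ∈ (Finset.range n).powerset,
      wick A hA (wedgeList K ((S.sort (· ≥ ·)).map E)) *
        wick B hB (wedgeList K ((S.sort (· ≥ ·)).map F))) ^ 2 =
      (1 - gramMatrix A (fun i : Fin n => E i) * gramMatrix B (fun i : Fin n => F i)).det := by
  have hC := directSumForm_isAlt hA hB
  have h1 := wick_prod_pairs_sq
    (Sum.elim (fun i : Fin n => ((E i, 0) : M × M')) fun i : Fin n => ((0, F i) : M × M'))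
    ((List.finRange n).reverse.map fun i => (Sum.inl i, Sum.inr i)) (directSumForm A B) hC
  rw [List.map_map, List.map_map] at h1
  have h2 := sum_pairMatrix K n
  have h3 : gramMatrix (directSumForm A B) (Sum.elim (fun i : Fin n => ((E i, 0) : M × M'))
      fun i : Fin n => ((0, F i) : M × M')) = Matrix.fromBlocks
        (gramMatrix A (fun i : Fin n => E i)) 0 0 (-gramMatrix B (fun i : Fin n => F i)) := by
    ext i j
    rcases i with i | i <;> rcases j with j | j <;> simp [gramMatrix, directSumForm_apply]
  have h4 : ((List.finRange n).reverse.map fun i : Fin n =>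
      1 + ι K ((E i, 0) : M × M') * ι K ((0, F i) : M × M')).prod =
      ((List.range n).reverse.map fun i =>
      1 + ι K ((E i, 0) : M × M') * ι K ((0, F i) : M × M')).prod := by
    rw [← List.map_coe_finRange_eq_range, ← List.map_reverse, List.map_map]
    rfl
  have h5 : (1 : Matrix (Fin n ⊕ Fin n) (Fin n ⊕ Fin n) K) = Matrix.fromBlocks 1 0 0 1 :=
    Matrix.fromBlocks_one.symm
  change wick _ hC ((List.finRange n).reverse.map fun i : Fin n =>
      1 + ι K ((E i, 0) : M × M') * ι K ((0, F i) : M × M')).prod ^ 2 =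
    (1 - _ * ((List.finRange n).reverse.map fun i => pairMatrix K
      ((Sum.inl i, Sum.inr i) : (Fin n ⊕ Fin n) × (Fin n ⊕ Fin n))).sum).det at h1
  rw [h4, prod_one_add_pairs, map_sum, h2, h3, Matrix.fromBlocks_multiply, h5,
    sub_eq_add_neg, Matrix.fromBlocks_neg, Matrix.fromBlocks_add] at h1
  simp only [wick_directSumForm A B hA hB] at h1
  rw [h1]
  simp only [mul_zero, add_zero, zero_add, mul_one, mul_neg, neg_neg, neg_zero]
  -- The matrix is now `[[1, -G_A], [-G_B, 1]]`, whose Schur complement is `1 - G_B G_A`.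
  rw [Matrix.det_fromBlocks_one₁₁, neg_mul_neg, Matrix.det_one_sub_mul_comm]

end SubsetSum

/-! ### Shifted tableaux with finitely many letters, and removal of the largest letter. -/

section CodedTableaux

/-- Tableaux of shifted shape with row lengths `L`, with the letters `m'` and `m` coded by the
numbers `2 * m` and `2 * m + 1`, all codes being less than `k`; entries outside the shape are `0`. -/
def codedTableaux (k : ℕ) (L : ℕ → ℕ) : Set (ℕ → ℕ → ℕ) :=
  {E | (∀ i j, j < L i → E i j < k) ∧ (∀ i j, L i ≤ j → E i j = 0) ∧
    (∀ i j j', j < j' → j' < L i → E i j ≤ E i j' ∧ (E i j = E i j' → E i j % 2 = 1)) ∧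
    (∀ i i' j j', i < i' → i + j = i' + j' → j < L i → j' < L i' →
      E i j ≤ E i' j' ∧ (E i j = E i' j' → E i j % 2 = 0))}

theorem codedTableaux_finite (k : ℕ) (N : ℕ) (L : ℕ → ℕ) (hL : ∀ i, N ≤ i → L i = 0) :
    (codedTableaux k L).Finite := by
  classical
  -- `B` bounds every row length, so a tableau is determined by an `N × B` array of bounded entries.
  set B := ∑ i ∈ Finset.range N, L i
  let g : (Fin N → Fin B → Fin (k + 1)) → ℕ → ℕ → ℕ := fun f i j =>
    if h : i < N ∧ j < B then f ⟨i, h.1⟩ ⟨j, h.2⟩ else 0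
  refine (Set.finite_range g).subset ?_
  rintro E ⟨h1, h2, -, -⟩
  have hE : ∀ i j, E i j < k + 1 := by
    intro i j
    rcases lt_or_ge j (L i) with h | h
    · exact (h1 i j h).trans (Nat.lt_succ_self k)
    · rw [h2 i j h]; exact Nat.succ_pos k
  refine ⟨fun i j => ⟨E i j, hE i j⟩, ?_⟩
  funext i j
  by_cases h : i < N ∧ j < B
  · simp [g, h]
  · simp only [g, h, dif_neg, not_false_eq_true]
    refine (h2 i j ?_).symm
    rcases lt_or_ge i N with hi | hi
    · have : L i ≤ B := Finset.single_le_sum (fun _ _ => Nat.zero_le _) (Finset.mem_range.2 hi)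
      have hj : ¬ j < B := fun hj => h ⟨hi, hj⟩
      omega
    · rw [hL i hi]; exact Nat.zero_le j

variable {R : Type*} [CommRing R]

/-- The monomial of a coded tableau with `N` rows. -/
def codedWeight (x : ℕ → R) (N : ℕ) (L : ℕ → ℕ) (E : ℕ → ℕ → ℕ) : R :=
  ∏ i ∈ Finset.range N, ∏ j ∈ Finset.range (L i), x (E i j / 2)

/-- The generating function of the coded tableaux with codes less than `k`. -/
noncomputable def codedSum (x : ℕ → R) (k N : ℕ) (L : ℕ → ℕ) : R :=
  ∑ᶠ E ∈ codedTableaux k L, codedWeight x N L E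

/-- The coded tableaux whose letters other than the largest letter `k` fill the shape `V`. -/
def codedFiber (k : ℕ) (L V : ℕ → ℕ) : Set (ℕ → ℕ → ℕ) :=
  {E ∈ codedTableaux (k + 1) L | ∀ i j, j < L i → (E i j < k ↔ j < V i)}

/-- Fill the boxes of `L` outside `V` with the letter `k`. -/
def extendTableau (k : ℕ) (L V : ℕ → ℕ) (E : ℕ → ℕ → ℕ) : ℕ → ℕ → ℕ := fun i j =>
  if j < V i then E i j else if j < L i then k else 0

/-- Here `hV` says that `V` is a shifted shape. The boxes of `L` outside `V` may all be filled with
`k` when they form a vertical strip (`h0`, `k` marked) or a horizontal strip (`h1`, `k` unmarked).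
In `h1` the shift `i' - i` compares columns: the new boxes of row `i` start to the right of the
whole of row `i'`. -/
theorem bijOn_extendTableau (k : ℕ) (L V : ℕ → ℕ) (hVL : ∀ i, V i ≤ L i)
    (hV : ∀ i i', i < i' → 0 < V i' → V i' + (i' - i) ≤ V i)
    (h0 : k % 2 = 0 → ∀ i, L i ≤ V i + 1)
    (h1 : k % 2 = 1 → ∀ i i', i < i' → 0 < L i' → L i' + (i' - i) ≤ V i) :
    Set.BijOn (extendTableau k L V) (codedTableaux k V) (codedFiber k L V) := by
  refine ⟨?_, ?_, ?_⟩
  · rintro E ⟨e1, e2, e3, e4⟩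
    refine ⟨⟨?_, ?_, ?_, ?_⟩, ?_⟩
    · intro i j hj
      by_cases h : j < V i
      · simp only [extendTableau, if_pos h]; exact (e1 i j h).trans (Nat.lt_succ_self k)
      · simp [extendTableau, h, hj]
    · intro i j hj
      have := hVL i
      simp [extendTableau, show ¬ j < V i by omega, show ¬ j < L i by omega]
    · intro i j j' hjj hj'
      by_cases h' : j' < V i
      · simp only [extendTableau, if_pos h', if_pos (hjj.trans h')]
        exact e3 i j j' hjj h'
      · by_cases h : j < V i
        · have := e1 i j h
          simp only [extendTableau, if_pos h, if_neg h', if_pos hj']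
          exact ⟨this.le, fun h => absurd h this.ne⟩
        · simp only [extendTableau, if_neg h, if_neg h', if_pos hj', if_pos (hjj.trans hj')]
          refine ⟨le_rfl, fun _ => ?_⟩
          by_contra hk
          have := h0 (by omega) i
          omega
    · intro i i' j j' hii hc hj hj'
      by_cases h : j < V i
      · by_cases h' : j' < V i'
        · simp only [extendTableau, if_pos h, if_pos h']
          exact e4 i i' j j' hii hc h h'
        · have := e1 i j h
          simp only [extendTableau, if_pos h, if_neg h', if_pos hj']
          exact ⟨this.le, fun h => absurd h this.ne⟩
      · have h' : ¬ j' < V i' := by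
          intro h'
          have := hV i i' hii (by omega)
          omega
        simp only [extendTableau, if_neg h, if_neg h', if_pos hj', if_pos hj]
        refine ⟨le_rfl, fun _ => ?_⟩
        by_contra hk
        have := h1 (by omega) i i' hii (by omega)
        omega
    · intro i j hj
      by_cases h : j < V i
      · simp [extendTableau, h, e1 i j h]
      · simp [extendTableau, h, hj]
  · rintro E ⟨-, e2, -⟩ F ⟨-, f2, -⟩ hEF
    funext i j
    by_cases h : j < V i
    · have := congrFun (congrFun hEF i) j
      simpa [extendTableau, h] using this
    · rw [e2 i j (not_lt.1 h), f2 i j (not_lt.1 h)]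
  · rintro E ⟨⟨e1, e2, e3, e4⟩, e5⟩
    have old : ∀ {i j}, j < V i → j < L i := fun {i j} h => h.trans_le (hVL i)
    refine ⟨fun i j => if j < V i then E i j else 0, ⟨?_, ?_, ?_, ?_⟩, ?_⟩
    · intro i j h
      simp only [if_pos h]
      exact (e5 i j (old h)).2 h
    · intro i j h
      simp [not_lt.2 h]
    · intro i j j' hjj h
      simp only [if_pos h, if_pos (hjj.trans h)]
      exact e3 i j j' hjj (old h)
    · intro i i' j j' hii hc h h'
      simp only [if_pos h, if_pos h']
      exact e4 i i' j j' hii hc (old h) (old h')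
    · funext i j
      by_cases h : j < V i
      · simp [extendTableau, h]
      · by_cases h' : j < L i
        · have h2 := e1 i j h'
          have h3 := (e5 i j h').not.2 h
          simp only [extendTableau, if_neg h, if_pos h']
          omega
        · simp [extendTableau, h, h', e2 i j (not_lt.1 h')]

theorem codedWeight_extendTableau (x : ℕ → R) (k N : ℕ) (L V : ℕ → ℕ) (hVL : ∀ i, V i ≤ L i)
    (E : ℕ → ℕ → ℕ) :
    codedWeight x N L (extendTableau k L V E) =
      x (k / 2) ^ (∑ i ∈ Finset.range N, (L i - V i)) * codedWeight x N V E := by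
  rw [codedWeight, codedWeight, ← Finset.prod_pow_eq_pow_sum, ← Finset.prod_mul_distrib]
  refine Finset.prod_congr rfl fun i _ => ?_
  rw [← Finset.prod_range_mul_prod_Ico _ (hVL i), mul_comm]
  congr 1
  · rw [Finset.prod_congr rfl (g := fun _ => x (k / 2)), Finset.prod_const, Nat.card_Ico]
    intro j hj
    have := Finset.mem_Ico.1 hj
    simp [extendTableau, this.2, not_lt.2 this.1]
  · refine Finset.prod_congr rfl fun j hj => ?_
    simp [extendTableau, Finset.mem_range.1 hj]

theorem sum_codedFiber (x : ℕ → R) (k N : ℕ) (L V : ℕ → ℕ) (hN : ∀ i, N ≤ i → L i = 0)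
    (hVL : ∀ i, V i ≤ L i)
    (hV : ∀ i i', i < i' → 0 < V i' → V i' + (i' - i) ≤ V i)
    (h0 : k % 2 = 0 → ∀ i, L i ≤ V i + 1)
    (h1 : k % 2 = 1 → ∀ i i', i < i' → 0 < L i' → L i' + (i' - i) ≤ V i) :
    ∑ᶠ E ∈ codedFiber k L V, codedWeight x N L E =
      x (k / 2) ^ (∑ i ∈ Finset.range N, (L i - V i)) * codedSum x k N V := by
  rw [codedSum, mul_finsum_mem' _ _ (codedTableaux_finite k N V
    fun i hi => Nat.le_zero.1 ((hVL i).trans (hN i hi).le))]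
  refine (finsum_mem_eq_of_bijOn _ (bijOn_extendTableau k L V hVL hV h0 h1) fun E _ => ?_).symm
  exact (codedWeight_extendTableau x k N L V hVL E).symm

/-- The number of letters less than `k` in each row. -/
def innerShape (k : ℕ) (L : ℕ → ℕ) (E : ℕ → ℕ → ℕ) (i : ℕ) : ℕ :=
  ((Finset.range (L i)).filter fun j => E i j < k).card

theorem innerShape_le (k : ℕ) (L : ℕ → ℕ) (E : ℕ → ℕ → ℕ) (i : ℕ) : innerShape k L E i ≤ L i := by
  simpa [innerShape] using Finset.card_filter_le (Finset.range (L i)) fun j => E i j < k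

theorem lt_innerShape_iff {k K : ℕ} {L : ℕ → ℕ} {E : ℕ → ℕ → ℕ} (hE : E ∈ codedTableaux K L)
    {i j : ℕ} (hj : j < L i) : E i j < k ↔ j < innerShape k L E i := by
  obtain ⟨-, -, e3, -⟩ := hE
  constructor
  · intro h
    have : Finset.range (j + 1) ⊆ (Finset.range (L i)).filter fun j => E i j < k := by
      intro a ha
      have ha := Finset.mem_range.1 ha
      refine Finset.mem_filter.2 ⟨Finset.mem_range.2 (by omega), ?_⟩
      rcases Nat.lt_or_ge a j with h' | h'
      · exact ((e3 i a j h' hj).1).trans_lt h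
      · have : a = j := by omega
        rwa [this]
    simpa [innerShape] using Finset.card_le_card this
  · intro h
    by_contra hc
    have : ((Finset.range (L i)).filter fun j => E i j < k) ⊆ Finset.range j := by
      intro a ha
      obtain ⟨ha1, ha2⟩ := Finset.mem_filter.1 ha
      refine Finset.mem_range.2 ?_
      by_contra h'
      rcases Nat.lt_or_ge j a with h'' | h''
      · have := (e3 i j a h'' (Finset.mem_range.1 ha1)).1
        omega
      · have : a = j := by omega
        exact hc (this ▸ ha2)
    have := Finset.card_le_card this
    rw [Finset.card_range] at this
    exact absurd h (not_lt.2 this)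

theorem mem_codedFiber_innerShape {k : ℕ} {L : ℕ → ℕ} {E : ℕ → ℕ → ℕ}
    (hE : E ∈ codedTableaux (k + 1) L) : E ∈ codedFiber k L (innerShape k L E) :=
  ⟨hE, fun _ _ hj => lt_innerShape_iff hE hj⟩

theorem eq_of_mem_codedFiber {k : ℕ} {L V W : ℕ → ℕ} {E : ℕ → ℕ → ℕ} (hV : E ∈ codedFiber k L V)
    (hW : E ∈ codedFiber k L W) (hVL : ∀ i, V i ≤ L i) (hWL : ∀ i, W i ≤ L i) : V = W := by
  funext i
  have h1 := hVL i
  have h2 := hWL i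
  have h3 := fun j hj => (hV.2 i j hj).symm.trans (hW.2 i j hj)
  rcases lt_trichotomy (V i) (W i) with h | h | h
  · exact absurd ((h3 (V i) (by omega)).2 h) (lt_irrefl _)
  · exact h
  · exact absurd ((h3 (W i) (by omega)).1 h) (lt_irrefl _)

/-- If the largest letter `k` is marked, it occurs at most once in a row. -/
theorem le_innerShape_add_one {k : ℕ} {L : ℕ → ℕ} {E : ℕ → ℕ → ℕ}
    (hE : E ∈ codedTableaux (k + 1) L) (hk : k % 2 = 0) (i : ℕ) :
    L i ≤ innerShape k L E i + 1 := by
  by_contra hc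
  set m := innerShape k L E i with hm
  have h1 := (lt_innerShape_iff (k := k) hE (i := i) (j := m) (by omega)).not.2 (by omega)
  have h2 := (lt_innerShape_iff (k := k) hE (i := i) (j := m + 1) (by omega)).not.2 (by omega)
  have h3 := hE.1 i m (by omega)
  have h4 := hE.1 i (m + 1) (by omega)
  have h5 := hE.2.2.1 i m (m + 1) (by omega) (by omega)
  have := h5.2 (by omega)
  omega

/-- If the largest letter `k` is unmarked, it occurs at most once in a column. -/
theorem lt_innerShape_of_odd {k : ℕ} {L : ℕ → ℕ} {E : ℕ → ℕ → ℕ}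
    (hE : E ∈ codedTableaux (k + 1) L) (hk : k % 2 = 1) (i : ℕ) (h : L (i + 1) < L i)
    (h0 : 0 < L (i + 1)) : L (i + 1) < innerShape k L E i := by
  by_contra hc
  have h1 := (lt_innerShape_iff (k := k) hE h).not.2 hc
  have h2 := hE.1 i _ h
  have h3 := hE.1 (i + 1) (L (i + 1) - 1) (by omega)
  have h4 := hE.2.2.2 i (i + 1) (L (i + 1)) (L (i + 1) - 1) (by omega) (by omega) h (by omega)
  have := h4.2 (by omega)
  omega

/-- The boxes of a column inside the inner shape lie above those outside. -/
theorem codedFiber_eq_empty {k : ℕ} {L V : ℕ → ℕ} (i : ℕ) (h : V i < L i)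
    (h1 : V i = V (i + 1)) (h2 : 0 < V (i + 1)) (h3 : V (i + 1) ≤ L (i + 1)) :
    codedFiber k L V = ∅ := by
  refine Set.eq_empty_of_forall_notMem ?_
  rintro E ⟨hE, hV⟩
  have e1 := (hV i (V i) h).not.2 (lt_irrefl _)
  have e2 := (hV (i + 1) (V (i + 1) - 1) (by omega)).2 (by omega)
  have := (hE.2.2.2 i (i + 1) (V i) (V (i + 1) - 1) (by omega) (by omega) h (by omega)).1
  omega

/-- Empty rows are harmless, which permits padding to an even number of rows. -/
theorem codedSum_succ_rows (x : ℕ → R) (k N : ℕ) (L : ℕ → ℕ) (h : L N = 0) :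
    codedSum x k (N + 1) L = codedSum x k N L := by
  simp [codedSum, codedWeight, Finset.prod_range_succ, h]

theorem codedSum_add_rows (x : ℕ → R) (k N m : ℕ) (L : ℕ → ℕ) (h : ∀ i, N ≤ i → L i = 0) :
    codedSum x k (N + m) L = codedSum x k N L := by
  induction m with
  | zero => rfl
  | succ m ih => rw [← add_assoc, codedSum_succ_rows _ _ _ _ (h _ (by omega)), ih]

end CodedTableaux

/-! ### Shapes recorded by strictly decreasing sites, and the shapes left after removing a letter.
-/

section Sites

open ExteriorAlgebra

variable {n : ℕ}

/-- Extension of a finite sequence by `0`. -/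
def siteExt (l : Fin n → ℕ) (i : ℕ) : ℕ := if h : i < n then l ⟨i, h⟩ else 0

/-- The row lengths of the shape in which row `i` is recorded by the site `l i`; the site `s + 1`
stands for a row of length `s`, and the site `0` for one more empty row. -/
def siteRows (l : Fin n → ℕ) (i : ℕ) : ℕ := siteExt l i - 1

theorem siteExt_val (l : Fin n → ℕ) (i : Fin n) : siteExt l i = l i := by simp [siteExt]

theorem siteExt_of_le (l : Fin n → ℕ) {i : ℕ} (h : n ≤ i) : siteExt l i = 0 := by
  simp [siteExt, not_lt.2 h]

theorem siteRows_of_le (l : Fin n → ℕ) {i : ℕ} (h : n ≤ i) : siteRows l i = 0 := by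
  simp [siteRows, siteExt_of_le l h]

theorem siteExt_gap {l : Fin n → ℕ} (hl : StrictAnti l) {i j : ℕ} (hij : i ≤ j)
    (hj : 0 < siteExt l j) : siteExt l j + (j - i) ≤ siteExt l i := by
  induction j, hij using Nat.le_induction with
  | base => simp
  | succ j hij ih =>
    have hjn : j + 1 < n := by
      by_contra h
      rw [siteExt_of_le l (not_lt.1 h)] at hj
      exact lt_irrefl _ hj
    have h1 : siteExt l (j + 1) < siteExt l j := by
      have := hl (show (⟨j, by omega⟩ : Fin n) < ⟨j + 1, hjn⟩ from Nat.lt_succ_self j)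
      simpa [siteExt, hjn, show j < n by omega] using this
    have := ih (by omega)
    omega

theorem siteExt_succ_lt {l : Fin n → ℕ} (hl : StrictAnti l) (i : Fin n) (h : l i ≠ 0) :
    siteExt l (i + 1) < l i := by
  by_cases h1 : 0 < siteExt l (i + 1)
  · have := siteExt_gap hl (Nat.le_succ (i : ℕ)) h1
    rw [siteExt_val] at this
    simp only [Nat.succ_eq_add_one] at this
    omega
  · omega

theorem strictAnti_of_succ {l : Fin n → ℕ}
    (h : ∀ i (hi : i + 1 < n), l ⟨i + 1, hi⟩ < l ⟨i, by omega⟩) : StrictAnti l := by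
  have key : ∀ (j : ℕ) (i : ℕ) (hij : i < j) (hj : j < n), l ⟨j, hj⟩ < l ⟨i, by omega⟩ := by
    intro j
    induction j with
    | zero => intro i hij; omega
    | succ j ih =>
      intro i hij hj
      rcases Nat.lt_succ_iff_lt_or_eq.1 hij with h' | h'
      · exact (h j hj).trans (ih i h' (by omega))
      · subst h'; exact h _ hj
  intro i j hij
  exact key j i hij j.2

/-- The sites to which row `i` may shrink when the letter `k` is removed. -/
def siteWindow (k : ℕ) (l : Fin n → ℕ) (i : Fin n) : Finset ℕ :=
  if l i = 0 then {0} else if k % 2 = 0 then Finset.Icc (l i - 1) (l i)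
    else Finset.Ioc (siteExt l (i + 1)) (l i)

theorem siteWindow_bounds {k : ℕ} {l : Fin n → ℕ} (h1 : ∀ i, l i ≠ 1) {i : Fin n} {s : ℕ}
    (hs : s ∈ siteWindow k l i) : s ≤ l i ∧ (s = 0 ↔ l i = 0) := by
  have := h1 i
  unfold siteWindow at hs
  split_ifs at hs with h h'
  · simp at hs; omega
  · simp at hs; omega
  · simp at hs; omega

variable {R : Type*} [CommRing R]

/-- The tableau generating function of the shape recorded by the sites `l`. -/
noncomputable def siteSum (x : ℕ → R) (k : ℕ) (l : Fin n → ℕ) : R := codedSum x k n (siteRows l)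

theorem sites_row_sub {k : ℕ} {l s : Fin n → ℕ} (h1 : ∀ i, l i ≠ 1)
    (hs : s ∈ Fintype.piFinset (siteWindow k l)) :
    ∑ i ∈ Finset.range n, (siteRows l i - siteRows s i) = ∑ i, (l i - s i) := by
  rw [Finset.sum_range]
  refine Finset.sum_congr rfl fun i _ => ?_
  have := siteWindow_bounds h1 (Fintype.mem_piFinset.1 hs i)
  simp only [siteRows, siteExt_val]
  omega

theorem siteRows_le {k : ℕ} {l s : Fin n → ℕ} (h1 : ∀ i, l i ≠ 1)
    (hs : s ∈ Fintype.piFinset (siteWindow k l)) (i : ℕ) : siteRows s i ≤ siteRows l i := by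
  by_cases hi : i < n
  · have := siteWindow_bounds h1 (Fintype.mem_piFinset.1 hs ⟨i, hi⟩)
    simp only [siteRows, siteExt, hi, dif_pos]
    omega
  · simp [siteRows_of_le s (not_lt.1 hi)]

/-- Tableaux are sorted by the shape that their letters below `k` fill. The condition `l i ≠ 1`
keeps the site `0`, which only pads, apart from the site `1` of a row that has been emptied. -/
theorem codedTableaux_eq_iUnion_codedFiber (k : ℕ) (l : Fin n → ℕ) (hl : StrictAnti l)
    (h1 : ∀ i, l i ≠ 1) :
    codedTableaux (k + 1) (siteRows l) =
      ⋃ s ∈ (Fintype.piFinset (siteWindow k l) : Set (Fin n → ℕ)),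
        codedFiber k (siteRows l) (siteRows s) := by
  ext E
  simp only [Set.mem_iUnion, exists_prop]
  constructor
  · intro hE
    set V := innerShape k (siteRows l) E with hV
    -- The padding row stays at the site `0`; a genuine row that becomes empty goes to the site `1`.
    let s : Fin n → ℕ := fun i => if l i = 0 then 0 else V i + 1
    have hsV : siteRows s = V := by
      funext i
      have hle : V i ≤ siteRows l i := innerShape_le k (siteRows l) E i
      by_cases hi : i < n
      · simp only [siteRows, siteExt, hi, dif_pos, s] at hle ⊢
        split_ifs with h
        · rw [h] at hle
          omega
        · simp
      · rw [siteRows_of_le l (not_lt.1 hi)] at hle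
        rw [siteRows_of_le s (not_lt.1 hi)]
        omega
    refine ⟨s, ?_, by rw [hsV]; exact mem_codedFiber_innerShape hE⟩
    rw [Finset.mem_coe, Fintype.mem_piFinset]
    intro i
    have h1i := h1 i
    have hle : V i ≤ l i - 1 := by
      have := innerShape_le k (siteRows l) E i
      rwa [siteRows, siteExt_val] at this
    unfold siteWindow
    split_ifs with h h'
    · simp [s, h]
    · have : siteRows l i ≤ V i + 1 := le_innerShape_add_one hE h' i
      rw [siteRows, siteExt_val] at this
      simp only [s, if_neg h, Finset.mem_Icc]
      omega
    · simp only [s, if_neg h, Finset.mem_Ioc]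
      have hlt := siteExt_succ_lt hl i h
      by_cases h0 : siteExt l (i + 1) = 0
      · omega
      · have hin : (i : ℕ) + 1 < n := by
          by_contra hc
          exact h0 (siteExt_of_le l (not_lt.1 hc))
        have h2 : siteExt l (i + 1) ≠ 1 := by
          simp only [siteExt, hin, dif_pos]; exact h1 _
        have : siteRows l (i + 1) < V i := lt_innerShape_of_odd hE (by omega) i
          (by simp only [siteRows, siteExt_val]; omega) (by simp only [siteRows]; omega)
        simp only [siteRows] at this
        omega
  · rintro ⟨s, -, hE⟩
    exact hE.1

theorem pairwiseDisjoint_codedFiber (k : ℕ) (l : Fin n → ℕ) (h1 : ∀ i, l i ≠ 1) :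
    (Fintype.piFinset (siteWindow k l) : Set (Fin n → ℕ)).PairwiseDisjoint
      fun s => codedFiber k (siteRows l) (siteRows s) := by
  intro s hs t ht hst
  refine Set.disjoint_left.2 fun E hE hE' => hst ?_
  have := eq_of_mem_codedFiber hE hE' (siteRows_le h1 hs) (siteRows_le h1 ht)
  funext i
  have h2 := congrFun this i
  have h3 := siteWindow_bounds h1 (Fintype.mem_piFinset.1 hs i)
  have h4 := siteWindow_bounds h1 (Fintype.mem_piFinset.1 ht i)
  simp only [siteRows, siteExt_val] at h2
  omega

theorem sum_siteFiber (x : ℕ → R) (k : ℕ) (l s : Fin n → ℕ) (hl : StrictAnti l)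
    (h1 : ∀ i, l i ≠ 1) (hs : s ∈ Fintype.piFinset (siteWindow k l)) (hs' : StrictAnti s) :
    ∑ᶠ E ∈ codedFiber k (siteRows l) (siteRows s), codedWeight x n (siteRows l) E =
      x (k / 2) ^ (∑ i, (l i - s i)) * siteSum x k s := by
  rw [sum_codedFiber x k n _ _ (fun i hi => siteRows_of_le l hi) (siteRows_le h1 hs),
    sites_row_sub h1 hs, siteSum]
  · intro i i' hii h
    simp only [siteRows] at h ⊢
    have := siteExt_gap hs' hii.le (by omega)
    omega
  · intro hk i
    by_cases hi : i < n
    · have := Fintype.mem_piFinset.1 hs ⟨i, hi⟩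
      have h2 := siteWindow_bounds h1 this
      unfold siteWindow at this
      simp only [siteRows, siteExt, hi, dif_pos]
      split_ifs at this with h
      · omega
      · simp at this; omega
    · simp [siteRows_of_le l (not_lt.1 hi)]
  · intro hk i i' hii h
    simp only [siteRows] at h ⊢
    have hi' : i' < n := by
      by_contra hc
      rw [siteExt_of_le l (not_lt.1 hc)] at h
      simp at h
    have hin : i < n := by omega
    have h3 := siteExt_gap hl (show i + 1 ≤ i' by omega) (by omega)
    have h5 := siteExt_gap hl hii.le (by omega)
    have := Fintype.mem_piFinset.1 hs ⟨i, hin⟩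
    unfold siteWindow at this
    have h4 : siteExt l i = l ⟨i, hin⟩ := by simp [siteExt, hin]
    have h6 : siteExt s i = s ⟨i, hin⟩ := by simp [siteExt, hin]
    rw [if_neg (by omega), if_neg (by omega), Finset.mem_Ioc] at this
    simp only at this
    omega

/-- Windows of a strictly decreasing sequence of sites overlap in at most one site. -/
theorem exists_eq_of_not_strictAnti {k : ℕ} {l s : Fin n → ℕ} (hl : StrictAnti l)
    (h1 : ∀ i, l i ≠ 1) (hs : s ∈ Fintype.piFinset (siteWindow k l)) (hs' : ¬ StrictAnti s) :
    ∃ i, ∃ hi : i + 1 < n, s ⟨i, by omega⟩ = s ⟨i + 1, hi⟩ ∧ s ⟨i, by omega⟩ < l ⟨i, by omega⟩ ∧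
      1 < s ⟨i + 1, hi⟩ := by
  by_contra hc
  refine hs' (strictAnti_of_succ fun i hi => ?_)
  by_contra hlt
  refine hc ⟨i, hi, ?_⟩
  have hin : i < n := by omega
  have a1 := Fintype.mem_piFinset.1 hs ⟨i, hin⟩
  have a2 := Fintype.mem_piFinset.1 hs ⟨i + 1, hi⟩
  have b1 := siteWindow_bounds h1 a1
  have b2 := siteWindow_bounds h1 a2
  have c1 := h1 ⟨i, hin⟩
  have c2 := h1 ⟨i + 1, hi⟩
  have d : l ⟨i + 1, hi⟩ < l ⟨i, hin⟩ := hl (Nat.lt_succ_self i)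
  have e1 : siteExt l (i + 1) = l ⟨i + 1, hi⟩ := by simp [siteExt, hi]
  unfold siteWindow at a1 a2
  rw [if_neg (by omega)] at a1
  split_ifs at a1 a2 with hk h0 h0
  · simp at a1 a2; omega
  · simp at a1 a2; omega
  · simp only [Finset.mem_Ioc] at a1; omega
  · simp only [Finset.mem_Ioc] at a1; omega

/-- If two adjacent rows acquire the same nonzero length and the upper one has shrunk, then a letter
`k` would stand directly above a smaller letter. In the wedge product the same terms vanish because
a vector is repeated. -/
theorem sum_siteFiber_of_not_strictAnti (x : ℕ → R) (k : ℕ) (l s : Fin n → ℕ) (hl : StrictAnti l)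
    (h1 : ∀ i, l i ≠ 1) (hs : s ∈ Fintype.piFinset (siteWindow k l)) (hs' : ¬ StrictAnti s) :
    ∑ᶠ E ∈ codedFiber k (siteRows l) (siteRows s), codedWeight x n (siteRows l) E = 0 := by
  obtain ⟨i, hi, h2, h3, h4⟩ := exists_eq_of_not_strictAnti hl h1 hs hs'
  have hin : i < n := by omega
  have := siteRows_le h1 hs (i + 1)
  rw [codedFiber_eq_empty i _ _ _ this, finsum_mem_empty] <;>
    simp only [siteRows, siteExt, hi, hin, dif_pos] <;> omega

end Sites

/-! ### Schur's Pfaffian formula for finitely many letters, by induction on the letters. -/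

section SiteForm

open ExteriorAlgebra

variable {K : Type*} [Field K]

/-- The bilinear form on finitely supported sequences with matrix `a`. -/
noncomputable def formOfMatrix (a : ℕ → ℕ → K) : LinearMap.BilinForm K (ℕ →₀ K) :=
  Finsupp.linearCombination K fun s => Finsupp.linearCombination K fun t => a s t

/-- The basis vector of a site. -/
noncomputable def siteVec (K : Type*) [Field K] (s : ℕ) : ℕ →₀ K := Finsupp.single s 1

theorem formOfMatrix_siteVec (a : ℕ → ℕ → K) (s t : ℕ) :
    formOfMatrix a (siteVec K s) (siteVec K t) = a s t := by
  simp [formOfMatrix, siteVec]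

theorem codedSum_of_forall_zero (x : ℕ → K) (k N : ℕ) (L : ℕ → ℕ) (hL : ∀ i, L i = 0) :
    codedSum x k N L = 1 := by
  have h : codedTableaux k L = {fun _ _ => 0} := by
    ext E
    constructor
    · rintro ⟨-, h, -⟩
      exact funext fun i => funext fun j => h i j (by rw [hL]; exact Nat.zero_le j)
    · rintro rfl
      exact ⟨fun i j h => by simp [hL] at h, fun _ _ _ => rfl, fun i j j' _ h => by simp [hL] at h,
        fun i i' j j' _ _ h => by simp [hL] at h⟩
  rw [codedSum, h, finsum_mem_singleton]
  simp [codedWeight, hL]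

theorem codedSum_zero (x : ℕ → K) (N : ℕ) (L : ℕ → ℕ) (i : ℕ) (hL : L i ≠ 0) :
    codedSum x 0 N L = 0 := by
  have h : codedTableaux 0 L = ∅ := by
    refine Set.eq_empty_of_forall_notMem fun E hE => ?_
    exact absurd (hE.1 i 0 (by omega)) (Nat.not_lt_zero _)
  rw [codedSum, h, finsum_mem_empty]

/-- The antisymmetric matrix of generating functions of shapes with at most two rows. -/
noncomputable def siteMatrix (x : ℕ → K) (k s t : ℕ) : K :=
  if t < s then siteSum x k ![s, t] else if s < t then - siteSum x k ![t, s] else 0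

theorem siteMatrix_neg (x : ℕ → K) (k s t : ℕ) : siteMatrix x k s t = - siteMatrix x k t s := by
  unfold siteMatrix
  split_ifs <;> first | omega | simp

theorem siteMatrix_self (x : ℕ → K) (k s : ℕ) : siteMatrix x k s s = 0 := by
  simp [siteMatrix]

/-- The sites `0` and `1` both stand for an empty row. -/
theorem siteMatrix_one (x : ℕ → K) (k s : ℕ) (hs : 1 < s) :
    siteMatrix x k s 1 = siteMatrix x k s 0 := by
  rw [siteMatrix, siteMatrix, if_pos hs, if_pos (by omega), siteSum, siteSum]
  congr 1
  funext i
  match i with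
  | 0 => simp [siteRows, siteExt]
  | 1 => simp [siteRows, siteExt]
  | i + 2 => simp [siteRows, siteExt]

theorem siteMatrix_one_zero (x : ℕ → K) (k : ℕ) : siteMatrix x k 1 0 = 1 := by
  rw [siteMatrix, if_pos one_pos, siteSum, codedSum_of_forall_zero]
  intro i
  match i with
  | 0 => simp [siteRows, siteExt]
  | 1 => simp [siteRows, siteExt]
  | i + 2 => simp [siteRows, siteExt]

/-- The effect of the letter `k` on a row. -/
noncomputable def letterVec (x : ℕ → K) (k s : ℕ) : ℕ →₀ K :=
  if s = 0 then siteVec K 0 else if k % 2 = 0 then siteVec K s + x (k / 2) • siteVec K (s - 1)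
    else ∑ t ∈ Finset.Ioc 0 s, x (k / 2) ^ (s - t) • siteVec K t

/-- Adding to a vector a multiple of the next one does not change a wedge product. -/
theorem ιMulti_eq_of_sub_next {M : Type*} [AddCommGroup M] [Module K M] :
    ∀ (n : ℕ) (v w : Fin n → M)
      (_ : ∀ i (hi : i + 1 < n), ∃ c : K, v ⟨i, by omega⟩ = w ⟨i, by omega⟩ + c • v ⟨i + 1, hi⟩)
      (_ : ∀ i (hi : i + 1 = n), v ⟨i, by omega⟩ = w ⟨i, by omega⟩),
      ιMulti K n v = ιMulti K n w
  | 0, _, _, _, _ => by simp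
  | n + 1, v, w, h, h' => by
    have ih : ιMulti K n (Fin.tail v) = ιMulti K n (Fin.tail w) :=
      ιMulti_eq_of_sub_next n _ _ (fun i hi => h (i + 1) (by omega))
        fun i hi => h' (i + 1) (by omega)
    rw [ιMulti_succ_tail, ιMulti_succ_tail, ← ih]
    match n, v, w, h, h' with
    | 0, v, w, h, h' => rw [show v 0 = w 0 from h' 0 rfl]
    | n + 1, v, w, h, h' =>
      obtain ⟨c, hc⟩ := h 0 (by omega)
      rw [show v 0 = w 0 + c • v 1 from hc, map_add, add_mul, map_smul, ιMulti_succ_tail,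
        smul_mul_assoc, ← mul_assoc (ι K (v 1)),
        show Fin.tail v 0 = v 1 from rfl, ι_sq_zero]
      simp

variable {n : ℕ}

/-- The window of a row depends on the next row when `k` is unmarked, whereas `letterVec` sums over
all positive sites up to `l i`. The surplus terms, with `t ≤ l (i + 1)`, are a power of the variable
times the letter vector of the next row, so they drop out of the wedge product. -/
theorem ιMulti_letterVec (x : ℕ → K) (k : ℕ) (l : Fin n → ℕ) (hl : StrictAnti l)
    (h1 : ∀ i, l i ≠ 1) :
    ιMulti K n (fun i => letterVec x k (l i)) =
      ιMulti K n fun i => ∑ s ∈ siteWindow k l i, x (k / 2) ^ (l i - s) • siteVec K s := by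
  rcases Nat.mod_two_eq_zero_or_one k with hk | hk
  · congr 1
    funext i
    have := h1 i
    unfold letterVec siteWindow
    by_cases h0 : l i = 0
    · simp [h0]
    · rw [if_neg h0, if_neg h0, if_pos hk, if_pos hk]
      obtain ⟨m, hm⟩ : ∃ m, l i = m + 1 := ⟨l i - 1, by omega⟩
      rw [hm, Nat.add_sub_cancel, ← Finset.insert_Icc_succ_left_eq_Icc (Nat.le_succ m)]
      simp [add_comm]
  · refine ιMulti_eq_of_sub_next n _ _ ?_ ?_
    · intro i hi
      have hin : i < n := by omega
      have hlt : l ⟨i + 1, hi⟩ < l ⟨i, hin⟩ := hl (Nat.lt_succ_self i)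
      have e1 : siteExt l (i + 1) = l ⟨i + 1, hi⟩ := by simp [siteExt, hi]
      unfold siteWindow
      simp only
      rw [if_neg (by omega), if_neg (by omega), e1]
      by_cases h0 : l ⟨i + 1, hi⟩ = 0
      · refine ⟨0, ?_⟩
        rw [letterVec, if_neg (by omega), if_neg (by omega), h0]
        simp
      · refine ⟨x (k / 2) ^ (l ⟨i, hin⟩ - l ⟨i + 1, hi⟩), ?_⟩
        rw [letterVec, if_neg (by omega), if_neg (by omega), letterVec, if_neg h0,
          if_neg (by omega), Finset.smul_sum, add_comm,
          ← Finset.sum_Ioc_consecutive _ (Nat.zero_le (l ⟨i + 1, hi⟩)) hlt.le]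
        congr 1
        refine Finset.sum_congr rfl fun t ht => ?_
        have := Finset.mem_Ioc.1 ht
        rw [smul_smul, ← pow_add]
        congr 2
        omega
    · intro i hi
      have hin : i < n := by omega
      have e1 : siteExt l (i + 1) = 0 := siteExt_of_le l (by omega)
      unfold siteWindow letterVec
      simp only
      rw [e1]
      by_cases h0 : l ⟨i, hin⟩ = 0
      · simp [h0]
      · rw [if_neg h0, if_neg h0, if_neg (by omega), if_neg (by omega)]

theorem ιMulti_letterVec_eq_sum (x : ℕ → K) (k : ℕ) (l : Fin n → ℕ) (hl : StrictAnti l)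
    (h1 : ∀ i, l i ≠ 1) :
    ιMulti K n (fun i => letterVec x k (l i)) =
      ∑ s ∈ Fintype.piFinset (siteWindow k l), x (k / 2) ^ (∑ i, (l i - s i)) •
        ιMulti K n fun i => siteVec K (s i) := by
  rw [ιMulti_letterVec x k l hl h1]
  have := (ιMulti K n (M := ℕ →₀ K)).toMultilinearMap.map_sum_finset
    (fun i s => x (k / 2) ^ (l i - s) • siteVec K s) (siteWindow k l)
  refine this.trans (Finset.sum_congr rfl fun s _ => ?_)
  rw [MultilinearMap.map_smul_univ, Finset.prod_pow_eq_pow_sum]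
  rfl

variable [CharZero K]

theorem formOfMatrix_isAlt (a : ℕ → ℕ → K) (ha : ∀ s t, a s t = - a t s) :
    (formOfMatrix a).IsAlt := by
  have h : formOfMatrix a = -(formOfMatrix a).flip := by
    ext s t
    simpa [formOfMatrix] using ha s t
  intro m
  have := congrArg (fun f : LinearMap.BilinForm K (ℕ →₀ K) => f m m) h
  simpa [self_eq_neg] using this

/-- The Gaussian functional of the matrix `siteMatrix`. -/
noncomputable def siteWick (x : ℕ → K) (k : ℕ) : ExteriorAlgebra K (ℕ →₀ K) →ₗ[K] K :=
  wick (formOfMatrix (siteMatrix x k)) (formOfMatrix_isAlt _ (siteMatrix_neg x k))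

theorem siteWick_pair (x : ℕ → K) (k : ℕ) (l : Fin 2 → ℕ) (hl : StrictAnti l) :
    siteWick x k (ιMulti K 2 fun i => siteVec K (l i)) = siteSum x k l := by
  have h : l 1 < l 0 := hl (by decide)
  have h2 : ![l 0, l 1] = l := by ext i; fin_cases i <;> rfl
  rw [siteWick, wick_ιMulti_two, formOfMatrix_siteVec, siteMatrix, if_pos h, h2]

/-- The Pfaffian formula for the letters less than `k`. -/
def PfaffianFormula (x : ℕ → K) (k : ℕ) : Prop :=
  ∀ (n : ℕ) (_ : Even n) (l : Fin n → ℕ) (_ : StrictAnti l),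
    siteSum x k l = siteWick x k (ιMulti K n fun i => siteVec K (l i))

/-- Both sides are sums over the inner shapes with the same powers of the variable. The induction
hypothesis handles the strictly decreasing `s`; for the others both terms vanish. -/
theorem siteSum_succ_eq_siteWick (x : ℕ → K) (k : ℕ) (hk : PfaffianFormula x k) (hn : Even n)
    (l : Fin n → ℕ) (hl : StrictAnti l) (h1 : ∀ i, l i ≠ 1) :
    siteSum x (k + 1) l = siteWick x k (ιMulti K n fun i => letterVec x k (l i)) := by
  rw [ιMulti_letterVec_eq_sum x k l hl h1, map_sum, siteSum, codedSum,
    codedTableaux_eq_iUnion_codedFiber k l hl h1,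
    finsum_mem_biUnion (pairwiseDisjoint_codedFiber k l h1) (Finset.finite_toSet _)
      fun s _ => (codedTableaux_finite (k + 1) n (siteRows l)
        fun i hi => siteRows_of_le l hi).subset fun E hE => hE.1,
    finsum_mem_coe_finset]
  refine Finset.sum_congr rfl fun s hs => ?_
  rw [map_smul, smul_eq_mul]
  by_cases hs' : StrictAnti s
  · rw [sum_siteFiber x k l s hl h1 hs hs', hk n hn s hs']
  · rw [sum_siteFiber_of_not_strictAnti x k l s hl h1 hs hs']
    obtain ⟨i, hi, h2, -⟩ := exists_eq_of_not_strictAnti hl h1 hs hs'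
    rw [(ιMulti K n).map_eq_zero_of_eq _ (i := ⟨i, by omega⟩) (j := ⟨i + 1, hi⟩)
      (by simp only [h2]) (by simp [Fin.ext_iff])]
    simp

/-- The case of two rows of `siteSum_succ_eq_siteWick`, where the Pfaffian is a single entry. It
identifies the Gram matrix of the letter vectors, hence all their Pfaffians. -/
theorem formOfMatrix_letterVec (x : ℕ → K) (k : ℕ) (hk : PfaffianFormula x k) (s t : ℕ)
    (hts : t < s) (hs : s ≠ 1) (ht : t ≠ 1) :
    formOfMatrix (siteMatrix x k) (letterVec x k s) (letterVec x k t) =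
      siteMatrix x (k + 1) s t := by
  have hl : StrictAnti ![s, t] := by
    intro i j hij
    fin_cases i <;> fin_cases j <;> simp_all
  have h := siteSum_succ_eq_siteWick x k hk even_two ![s, t] hl
    (by intro i; fin_cases i <;> simp_all)
  rw [siteWick, wick_ιMulti_two] at h
  rw [siteMatrix, if_pos hts, h]
  rfl

theorem siteSum_succ_of_ne_one (x : ℕ → K) (k : ℕ) (hk : PfaffianFormula x k) (hn : Even n)
    (l : Fin n → ℕ) (hl : StrictAnti l) (h1 : ∀ i, l i ≠ 1) :
    siteSum x (k + 1) l = siteWick x (k + 1) (ιMulti K n fun i => siteVec K (l i)) := by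
  rw [siteSum_succ_eq_siteWick x k hk hn l hl h1]
  refine wick_ιMulti_congr _ _ _ _ _ _ _ fun i j hij => ?_
  rw [formOfMatrix_letterVec x k hk _ _ (hl hij) (h1 i) (h1 j), formOfMatrix_siteVec]

/-- Without letters only empty shapes contribute. With more than two strictly decreasing sites the
first row is nonempty, so the generating function and the first row of the Pfaffian both vanish. -/
theorem pfaffianFormula_zero (x : ℕ → K) : PfaffianFormula x 0 := by
  intro n hn l hl
  match n, hn, l, hl with
  | 0, _, l, hl =>
    rw [siteSum, codedSum_of_forall_zero _ _ _ _ fun i => siteRows_of_le l (Nat.zero_le i),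
      ιMulti_zero_apply, siteWick, wick_one]
  | 1, hn, _, _ => simp at hn
  | 2, _, l, hl => rw [siteWick_pair x 0 l hl]
  | n + 3, _, l, hl =>
    have h21 : l ⟨2, by omega⟩ < l ⟨1, by omega⟩ := hl (Nat.lt_succ_self 1)
    have h10 : l ⟨1, by omega⟩ < l 0 := hl (Nat.lt_succ_self 0)
    have h0 : 2 ≤ l 0 := by omega
    rw [siteSum, codedSum_zero _ _ _ 0 (by
      simp only [siteRows, siteExt, Nat.zero_lt_succ, dif_pos]
      change l 0 - 1 ≠ 0
      omega), siteWick, wick_ιMulti_succ_succ]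
    refine (Finset.sum_eq_zero fun j _ => ?_).symm
    rw [formOfMatrix_siteVec, siteMatrix, if_pos (hl (Fin.succ_pos j)), siteSum,
      codedSum_zero _ _ _ 0]
    · simp
    · simp [siteRows, siteExt]; omega

/-- The vector `e₁ - e₀` is orthogonal to all `e_s` with `s > 1` and pairs to `1` with `e₀`. As `e₁
∧ e₀ = (e₁ - e₀) ∧ e₀`, Wick's rule removes the two empty rows with factor `1`. -/
theorem siteWick_mul_ghosts (x : ℕ → K) (k : ℕ) (l : Fin n → ℕ) (hl : ∀ i, 1 < l i) :
    siteWick x k (ιMulti K n (fun i => siteVec K (l i)) * (ι K (siteVec K 1) * ι K (siteVec K 0))) =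
      siteWick x k (ιMulti K n fun i => siteVec K (l i)) := by
  set w : ℕ →₀ K := siteVec K 1 - siteVec K 0 with hw
  have h1 : ι K (siteVec K 1) * ι K (siteVec K 0) = ι K w * ι K (siteVec K 0) := by
    rw [hw, map_sub, sub_mul, ι_sq_zero, sub_zero]
  have h2 : ∀ m ∈ List.ofFn (fun i => siteVec K (l i)), formOfMatrix (siteMatrix x k) w m = 0 := by
    intro m hm
    obtain ⟨i, rfl⟩ := (List.mem_ofFn' _ _).1 hm
    rw [hw, map_sub, LinearMap.sub_apply, formOfMatrix_siteVec, formOfMatrix_siteVec, siteMatrix_neg, siteMatrix_one x k _ (hl i), siteMatrix_neg x k 0,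
      sub_self]
  have h3 : formOfMatrix (siteMatrix x k) w (siteVec K 0) = 1 := by
    rw [hw, map_sub, LinearMap.sub_apply, formOfMatrix_siteVec,
      formOfMatrix_siteVec, siteMatrix_one_zero, siteMatrix_self, sub_zero]
  rw [h1, ← (commute_ι_mul_ι w (siteVec K 0) _).eq, mul_assoc, siteWick, wick_ι_mul,
    contractLeft_ι_mul', ← wedgeList_ofFn, contractLeft_wedgeList_of_forall _ _ h2, h3]
  simp

/-- The site `1` cannot be left out of the induction, since removing a letter may empty a row. It is
reduced to sequences avoiding `1`: a final `1` is replaced by `0`, and a final pair `1, 0` is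
deleted. -/
theorem pfaffianFormula_succ (x : ℕ → K) (k : ℕ) (hk : PfaffianFormula x k) :
    PfaffianFormula x (k + 1) := by
  intro n hn l hl
  by_cases h1 : ∀ i, l i ≠ 1
  · exact siteSum_succ_of_ne_one x k hk hn l hl h1
  obtain ⟨a, ha⟩ : ∃ i, l i = 1 := by simpa using h1
  match n, hn, l, hl, a, ha with
  | 1, hn, _, _, _, _ => simp at hn
  | m + 2, hn, l, hl, a, ha =>
    have hlast : ∀ i : Fin (m + 2), a < i → i = Fin.last (m + 1) ∧ l i = 0 := by
      intro i hi
      have h2 : l i < l a := hl hi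
      refine ⟨?_, by omega⟩
      by_contra hc
      have h3 : l (Fin.last (m + 1)) < l i := hl (lt_of_le_of_ne (Fin.le_last i) hc)
      omega
    by_cases hal : a = Fin.last (m + 1)
    · subst hal
      set l' := Function.update l (Fin.last (m + 1)) 0 with hl'
      have hbig : ∀ i, i ≠ Fin.last (m + 1) → 1 < l i := fun i hi =>
        ha ▸ hl (lt_of_le_of_ne (Fin.le_last i) hi)
      have hl'a : StrictAnti l' := by
        intro i j hij
        have hi : i ≠ Fin.last (m + 1) := (hij.trans_le (Fin.le_last j)).ne
        rw [hl', Function.update_of_ne hi]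
        by_cases hj : j = Fin.last (m + 1)
        · subst hj; rw [Function.update_self]; have := hbig i hi; omega
        · rw [Function.update_of_ne hj]; exact hl hij
      have hrows : siteRows l = siteRows l' := by
        funext i
        by_cases hi : i < m + 2
        · simp only [siteRows, siteExt, hi, dif_pos]
          by_cases hi' : (⟨i, hi⟩ : Fin (m + 2)) = Fin.last (m + 1)
          · rw [hi', hl', Function.update_self, ha]
          · rw [hl', Function.update_of_ne hi']
        · rw [siteRows_of_le l (not_lt.1 hi), siteRows_of_le l' (not_lt.1 hi)]
      have hA := siteSum_succ_of_ne_one x k hk hn l' hl'a (by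
        intro i
        by_cases hi : i = Fin.last (m + 1)
        · subst hi; simp [hl']
        · rw [hl', Function.update_of_ne hi]; exact (hbig i hi).ne')
      rw [siteSum, hrows, ← siteSum, hA]
      refine wick_ιMulti_congr _ _ _ _ _ _ _ fun i j hij => ?_
      have hi : i ≠ Fin.last (m + 1) := (hij.trans_le (Fin.le_last j)).ne
      simp only [formOfMatrix_siteVec]
      rw [hl', Function.update_of_ne hi]
      by_cases hj : j = Fin.last (m + 1)
      · subst hj; rw [Function.update_self, ha, siteMatrix_one x _ _ (hbig i hi)]
      · rw [Function.update_of_ne hj]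
    · obtain ⟨-, hz⟩ := hlast (Fin.last (m + 1)) (lt_of_le_of_ne (Fin.le_last a) hal)
      have ham : (a : ℕ) = m := by
        by_contra hne
        have h2 : (a : ℕ) < m + 1 := lt_of_le_of_ne (Nat.lt_succ_iff.1 a.2)
          fun h => hal (Fin.ext h)
        have h3 := (hlast ⟨m, by omega⟩ (show (a : ℕ) < m by omega)).1
        simp [Fin.ext_iff] at h3
      have hlm : l ⟨m, by omega⟩ = 1 := by
        rw [← ha]; congr 1; exact Fin.ext ham.symm
      set l' : Fin m → ℕ := fun i => l (Fin.castAdd 2 i) with hl'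
      have hbig : ∀ i, 1 < l' i := fun i => hlm ▸ hl (show (i : ℕ) < m from i.2)
      have hA := siteSum_succ_of_ne_one x k hk
        (by simpa [parity_simps] using hn) l' (fun i j hij => hl hij) fun i => (hbig i).ne'
      have hrows : siteRows l = siteRows l' := by
        funext i
        rcases lt_trichotomy i m with hi | hi | hi
        · simp [siteRows, siteExt, hi, show i < m + 2 by omega, hl', Fin.castAdd, Fin.castLE]
        · rw [siteRows_of_le l' hi.ge]
          subst hi
          simp [siteRows, siteExt, hlm]
        · rw [siteRows_of_le l' hi.le]
          by_cases hi' : i = m + 1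
          · subst hi'
            have : l ⟨m + 1, by omega⟩ = 0 := hz
            simp [siteRows, siteExt, this]
          · exact siteRows_of_le l (by omega)
      rw [siteSum, hrows, codedSum_add_rows x (k + 1) m 2 _ fun i hi => siteRows_of_le l' hi,
        ← siteSum, hA, ← siteWick_mul_ghosts x (k + 1) l' hbig]
      have h2 : ι K (siteVec K 1) * ι K (siteVec K 0) =
          ιMulti K 2 (fun i => siteVec K (l (Fin.natAdd m i))) := by
        have e0 : l (Fin.natAdd m 0) = 1 := hlm
        have e1 : l (Fin.natAdd m 1) = 0 := hz
        rw [ιMulti_succ_tail, ιMulti_succ_tail]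
        simp [Fin.tail, e0, e1]
      rw [h2, ιMulti_mul_ιMulti]
      congr 2
      exact Fin.append_castAdd_natAdd (f := fun i => siteVec K (l i))

theorem pfaffianFormula (x : ℕ → K) : ∀ k, PfaffianFormula x k
  | 0 => pfaffianFormula_zero x
  | k + 1 => pfaffianFormula_succ x k (pfaffianFormula x k)

end SiteForm

/-! ### Coded tableaux and shifted tableaux correspond. -/

section Encoding

/-- The number coding a letter: `2 * m` for the marked and `2 * m + 1` for the unmarked one. -/
def MarkedLetter.code (a : MarkedLetter) : ℕ := 2 * (ofLex a).1 + (ofLex a).2.toNat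

theorem MarkedLetter.code_div_two (a : MarkedLetter) : a.code / 2 = a.index := by
  unfold MarkedLetter.code MarkedLetter.index
  rcases (ofLex a).2 <;> simp; omega

theorem MarkedLetter.isMarked_iff (a : MarkedLetter) : a.IsMarked ↔ a.code % 2 = 0 := by
  unfold MarkedLetter.code MarkedLetter.IsMarked
  rcases (ofLex a).2 <;> simp

theorem MarkedLetter.code_le_code (a b : MarkedLetter) : a.code ≤ b.code ↔ a ≤ b := by
  rw [Prod.Lex.le_iff]
  unfold MarkedLetter.code
  rcases h : (ofLex a).2 <;> rcases h' : (ofLex b).2 <;> simp <;> omega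

theorem MarkedLetter.code_injective : Function.Injective MarkedLetter.code := fun a b h =>
  le_antisymm ((code_le_code a b).1 h.le) ((code_le_code b a).1 h.ge)

/-- The letter with a given code. -/
def MarkedLetter.ofCode (c : ℕ) : MarkedLetter := toLex (c / 2, decide (c % 2 = 1))

theorem MarkedLetter.code_ofCode (c : ℕ) : (MarkedLetter.ofCode c).code = c := by
  unfold MarkedLetter.code MarkedLetter.ofCode
  rcases Nat.mod_two_eq_zero_or_one c with h | h <;> simp [h] <;> omega

/-- The row lengths of a list, extended by `0`. -/
def rowsFun (rows : List ℕ) (i : ℕ) : ℕ := rows.getD i 0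

theorem rowsFun_val (rows : List ℕ) (i : Fin rows.length) : rowsFun rows i = rows.get i := by
  simp [rowsFun]

theorem rowsFun_of_le (rows : List ℕ) {i : ℕ} (h : rows.length ≤ i) : rowsFun rows i = 0 := by
  simp [rowsFun, h]

/-- The box in row `i` and position `j`. -/
def cellOf {rows : List ℕ} (i j : ℕ) (h : j < rowsFun rows i) : ShiftedCell rows :=
  have hi : i < rows.length := by
    by_contra hc
    rw [rowsFun_of_le rows (not_lt.1 hc)] at h
    exact Nat.not_lt_zero _ h
  ⟨⟨i, hi⟩, ⟨j, (rowsFun_val rows ⟨i, hi⟩) ▸ h⟩⟩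

theorem cell_lt {rows : List ℕ} (c : ShiftedCell rows) : (c.2 : ℕ) < rowsFun rows c.1 := by
  rw [rowsFun_val]; exact c.2.2

theorem cellOf_self {rows : List ℕ} (c : ShiftedCell rows) : cellOf c.1 c.2 (cell_lt c) = c := rfl

theorem cell_ext {rows : List ℕ} {c d : ShiftedCell rows} (h : (c.1 : ℕ) = d.1)
    (h' : (c.2 : ℕ) = d.2) : c = d := by
  obtain ⟨⟨i, hi⟩, ⟨j, hj⟩⟩ := c
  obtain ⟨⟨i', hi'⟩, ⟨j', hj'⟩⟩ := d
  simp only at h h'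
  subst h h'
  rfl

theorem cellOf_inj {rows : List ℕ} {i j i' j' : ℕ} {h : j < rowsFun rows i}
    {h' : j' < rowsFun rows i'} (hc : cellOf i j h = cellOf i' j' h') : i = i' ∧ j = j' :=
  ⟨congrArg (fun c : ShiftedCell rows => (c.1 : ℕ)) hc,
    congrArg (fun c : ShiftedCell rows => (c.2 : ℕ)) hc⟩

open Classical in
/-- The coded tableau of a shifted tableau. -/
noncomputable def ShiftedTableau.encode {rows : List ℕ} (T : ShiftedTableau rows) (i j : ℕ) : ℕ :=
  if h : j < rowsFun rows i then (T.entry (cellOf i j h)).code else 0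

theorem ShiftedTableau.encode_cell {rows : List ℕ} (T : ShiftedTableau rows)
    (c : ShiftedCell rows) : T.encode c.1 c.2 = (T.entry c).code := by
  rw [encode, dif_pos (cell_lt c), cellOf_self]

/-- The shifted tableaux with all codes less than `k`. -/
def boundedTableaux (k : ℕ) (rows : List ℕ) : Set (ShiftedTableau rows) :=
  {T | ∀ c, (T.entry c).code < k}

theorem ShiftedTableau.ext_entry {rows : List ℕ} {S T : ShiftedTableau rows}
    (h : S.entry = T.entry) : S = T := by
  cases S; cases T; simp only at h; subst h; rfl

theorem bijOn_encode (k : ℕ) (rows : List ℕ) :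
    Set.BijOn ShiftedTableau.encode (boundedTableaux k rows)
      (codedTableaux k (rowsFun rows)) := by
  refine ⟨?_, ?_, ?_⟩
  · intro T hT
    refine ⟨?_, ?_, ?_, ?_⟩
    · intro i j h
      rw [ShiftedTableau.encode, dif_pos h]; exact hT _
    · intro i j h
      rw [ShiftedTableau.encode, dif_neg (not_lt.2 h)]
    · intro i j j' hjj h'
      have h := hjj.trans h'
      rw [ShiftedTableau.encode, dif_pos h, ShiftedTableau.encode, dif_pos h']
      refine ⟨(MarkedLetter.code_le_code _ _).2 (T.row_weak _ _ rfl ?_), fun he => ?_⟩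
      · simp only [ShiftedCell.col, cellOf]; omega
      · by_contra hm
        have := T.row_marked (cellOf i j h) (cellOf i j' h') rfl (MarkedLetter.code_injective he)
          ((MarkedLetter.isMarked_iff _).2 (by omega))
        exact hjj.ne (cellOf_inj this).2
    · intro i i' j j' hii hc h h'
      rw [ShiftedTableau.encode, dif_pos h, ShiftedTableau.encode, dif_pos h']
      refine ⟨(MarkedLetter.code_le_code _ _).2 (T.col_weak _ _ hc hii), fun he => ?_⟩
      by_contra hm
      have := T.col_unmarked (cellOf i j h) (cellOf i' j' h') hc (MarkedLetter.code_injective he)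
        ((MarkedLetter.isMarked_iff _).not.2 hm)
      exact hii.ne (cellOf_inj this).1
  · intro S _ T _ hST
    refine ShiftedTableau.ext_entry (funext fun c => MarkedLetter.code_injective ?_)
    rw [← S.encode_cell, ← T.encode_cell, hST]
  · rintro E ⟨e1, e2, e3, e4⟩
    let T : ShiftedTableau rows :=
      { entry := fun c => MarkedLetter.ofCode (E c.1 c.2)
        row_weak := by
          intro c d hcd hlt
          rw [← MarkedLetter.code_le_code, MarkedLetter.code_ofCode, MarkedLetter.code_ofCode]
          have hcd' : (c.1 : ℕ) = d.1 := congrArg Fin.val hcd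
          rw [hcd']
          exact (e3 d.1 c.2 d.2 (by simp only [ShiftedCell.col] at hlt; omega) (cell_lt d)).1
        col_weak := by
          intro c d hcol hlt
          rw [← MarkedLetter.code_le_code, MarkedLetter.code_ofCode, MarkedLetter.code_ofCode]
          exact (e4 c.1 d.1 c.2 d.2 hlt hcol (cell_lt c) (cell_lt d)).1
        row_marked := by
          intro c d hcd he hm
          have he' := congrArg MarkedLetter.code he
          rw [MarkedLetter.isMarked_iff] at hm
          rw [MarkedLetter.code_ofCode] at he' hm
          rw [MarkedLetter.code_ofCode] at he'
          have hcd' : (c.1 : ℕ) = d.1 := congrArg Fin.val hcd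
          refine cell_ext hcd' ?_
          rw [hcd'] at he' hm
          rcases lt_trichotomy (c.2 : ℕ) d.2 with h | h | h
          · have := (e3 d.1 c.2 d.2 h (cell_lt d)).2 he'
            omega
          · exact h
          · have := (e3 d.1 d.2 c.2 h (hcd' ▸ cell_lt c)).2 he'.symm
            omega
        col_unmarked := by
          intro c d hcol he hm
          have he' := congrArg MarkedLetter.code he
          rw [MarkedLetter.isMarked_iff] at hm
          rw [MarkedLetter.code_ofCode] at he' hm
          rw [MarkedLetter.code_ofCode] at he'
          simp only [ShiftedCell.col] at hcol
          rcases lt_trichotomy (c.1 : ℕ) d.1 with h | h | h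
          · exact absurd ((e4 c.1 d.1 c.2 d.2 h hcol (cell_lt c) (cell_lt d)).2 he') hm
          · exact cell_ext h (by omega)
          · have := (e4 d.1 c.1 d.2 c.2 h hcol.symm (cell_lt d) (cell_lt c)).2 he'.symm
            omega }
    refine ⟨T, ?_, ?_⟩
    · intro c
      simp only [T, MarkedLetter.code_ofCode]
      exact e1 _ _ (cell_lt c)
    · funext i j
      by_cases h : j < rowsFun rows i
      · rw [ShiftedTableau.encode, dif_pos h]
        simp only [T, MarkedLetter.code_ofCode]
        rfl
      · rw [ShiftedTableau.encode, dif_neg h, e2 i j (not_lt.1 h)]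

theorem codedWeight_encode {R : Type*} [CommRing R] (x : ℕ → R) {rows : List ℕ}
    (T : ShiftedTableau rows) :
    codedWeight x rows.length (rowsFun rows) T.encode = T.weight x := by
  rw [codedWeight, ShiftedTableau.weight, Fintype.prod_sigma, Finset.prod_range]
  refine Finset.prod_congr rfl fun i _ => ?_
  rw [rowsFun_val, Finset.prod_range]
  refine Finset.prod_congr rfl fun j _ => ?_
  have := T.encode_cell ⟨i, j⟩
  simp only at this
  rw [this, MarkedLetter.code_div_two]

theorem boundedTableaux_finite (k : ℕ) (rows : List ℕ) : (boundedTableaux k rows).Finite :=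
  (bijOn_encode k rows).finite_iff_finite.2
    (codedTableaux_finite k rows.length _ fun _ hi => rowsFun_of_le rows hi)

theorem codedSum_eq_sum_weight {R : Type*} [CommRing R] (x : ℕ → R) (k : ℕ) (rows : List ℕ) :
    codedSum x k rows.length (rowsFun rows) =
      ∑ T ∈ (boundedTableaux_finite k rows).toFinset, T.weight x := by
  rw [codedSum, ← finsum_mem_eq_of_bijOn _ (bijOn_encode k rows)
    fun T _ => (codedWeight_encode x T).symm, finsum_mem_eq_finite_toFinset_sum]

end Encoding

/-! ### Summability, and passage to infinitely many letters. -/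

section Convergence

variable {𝕜 : Type*} [RCLike 𝕜]

/-- A finite set of functions lies in a box of finite sets, over which the sum of products factors
into a product of partial sums. -/
theorem summable_pi_prod {ι α : Type*} [Fintype ι] {u : α → ℝ} (hu : ∀ a, 0 ≤ u a)
    (hs : Summable u) : Summable fun f : ι → α => ∏ i, u (f i) := by
  classical
  refine summable_of_sum_le (c := ∏ _i : ι, ∑' a, u a)
    (fun f => Finset.prod_nonneg fun i _ => hu _) fun s => ?_
  calc ∑ f ∈ s, ∏ i, u (f i)
      ≤ ∑ f ∈ Fintype.piFinset (fun i => s.image fun f => f i), ∏ i, u (f i) := by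
        refine Finset.sum_le_sum_of_subset_of_nonneg (fun f hf => ?_)
          fun f _ _ => Finset.prod_nonneg fun i _ => hu _
        exact Fintype.mem_piFinset.2 fun i => Finset.mem_image_of_mem _ hf
    _ = ∏ i, ∑ a ∈ s.image (fun f => f i), u a := (Finset.prod_univ_sum _ _).symm
    _ ≤ ∏ _i : ι, ∑' a, u a := Finset.prod_le_prod
        (fun i _ => Finset.sum_nonneg fun a _ => hu a)
        fun i _ => hs.sum_le_tsum _ fun a _ => hu a

/-- The tableaux are among all fillings of the boxes, whose weights are absolutely summable. -/
theorem summable_weight (x : ℕ → 𝕜) (hx : Summable fun i => ‖x i‖) (rows : List ℕ) :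
    Summable fun T : ShiftedTableau rows => T.weight x := by
  have h1 : Summable fun p : ℕ × Bool => ‖x p.1‖ := by
    have h2 : Summable fun _ : Bool => (1 : ℝ) := (hasSum_fintype _).summable
    simpa using hx.mul_of_nonneg h2 (fun _ => norm_nonneg _) fun _ => zero_le_one
  have h2 : Summable fun a : MarkedLetter => ‖x a.index‖ :=
    (Equiv.summable_iff (ofLex : MarkedLetter ≃ ℕ × Bool)).2 h1
  have h3 := summable_pi_prod (ι := ShiftedCell rows) (fun _ => norm_nonneg _) h2
  have h4 : Function.Injective (ShiftedTableau.entry : ShiftedTableau rows → _) :=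
    fun S T h => ShiftedTableau.ext_entry h
  refine Summable.of_norm ?_
  simpa [ShiftedTableau.weight, norm_prod, Function.comp_def] using h3.comp_injective h4

theorem tendsto_codedSum (x : ℕ → 𝕜) (hx : Summable fun i => ‖x i‖) (rows : List ℕ) :
    Filter.Tendsto (fun k => codedSum x k rows.length (rowsFun rows)) Filter.atTop
      (nhds (schurQ rows x)) := by
  simp only [codedSum_eq_sum_weight]
  refine (summable_weight x hx rows).hasSum.comp (Filter.tendsto_atTop_finset_of_monotone ?_ ?_)
  · intro k k' hk T hT
    rw [Set.Finite.mem_toFinset] at hT ⊢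
    exact fun c => (hT c).trans_le hk
  · intro T
    -- This sum exceeds the code of every entry of `T`, so `T` is counted from there on.
    refine ⟨∑ c, ((T.entry c).code + 1), ?_⟩
    rw [Set.Finite.mem_toFinset]
    intro c
    exact Nat.lt_of_succ_le
      (Finset.single_le_sum (f := fun c => (T.entry c).code + 1) (fun _ _ => Nat.zero_le _)
        (Finset.mem_univ c))

theorem tendsto_siteSum (x : ℕ → 𝕜) (hx : Summable fun i => ‖x i‖) {n : ℕ} (l : Fin n → ℕ)
    (rows : List ℕ) (h : siteRows l = rowsFun rows) (hn : rows.length ≤ n) :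
    Filter.Tendsto (fun k => siteSum x k l) Filter.atTop (nhds (schurQ rows x)) := by
  obtain ⟨m, rfl⟩ := Nat.exists_eq_add_of_le hn
  have : ∀ k, siteSum x k l = codedSum x k rows.length (rowsFun rows) := fun k => by
    rw [siteSum, h, codedSum_add_rows _ _ _ _ _ fun i hi => rowsFun_of_le rows hi]
  simp only [this]
  exact tendsto_codedSum x hx rows

theorem siteRows_pair (s t : ℕ) : siteRows ![s, t] = rowsFun [s - 1, t - 1] := by
  funext i
  match i with
  | 0 => simp [siteRows, siteExt, rowsFun]
  | 1 => simp [siteRows, siteExt, rowsFun]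
  | i + 2 => simp [siteRows, siteExt, rowsFun]

/-- The antisymmetric matrix of the `Q`-functions of shapes with at most two rows. -/
noncomputable def limitMatrix (x : ℕ → 𝕜) (s t : ℕ) : 𝕜 :=
  if t < s then schurQ [s - 1, t - 1] x else if s < t then - schurQ [t - 1, s - 1] x else 0

theorem limitMatrix_neg (x : ℕ → 𝕜) (s t : ℕ) : limitMatrix x s t = - limitMatrix x t s := by
  unfold limitMatrix
  split_ifs <;> first | omega | simp

theorem tendsto_siteMatrix (x : ℕ → 𝕜) (hx : Summable fun i => ‖x i‖) (s t : ℕ) :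
    Filter.Tendsto (fun k => siteMatrix x k s t) Filter.atTop (nhds (limitMatrix x s t)) := by
  unfold siteMatrix limitMatrix
  split_ifs
  · exact tendsto_siteSum x hx _ _ (siteRows_pair s t) le_rfl
  · exact (tendsto_siteSum x hx _ _ (siteRows_pair t s) le_rfl).neg
  · exact tendsto_const_nhds

/-- The Gaussian functional of the matrix `limitMatrix`. -/
noncomputable def limitWick (x : ℕ → 𝕜) : ExteriorAlgebra 𝕜 (ℕ →₀ 𝕜) →ₗ[𝕜] 𝕜 :=
  wick (formOfMatrix (limitMatrix x)) (formOfMatrix_isAlt _ (limitMatrix_neg x))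

/-- Schur's Pfaffian formula. -/
theorem schurQ_eq_limitWick (x : ℕ → 𝕜) (hx : Summable fun i => ‖x i‖) {n : ℕ} (hn : Even n)
    (l : Fin n → ℕ) (hl : StrictAnti l) (rows : List ℕ) (h : siteRows l = rowsFun rows)
    (hrows : rows.length ≤ n) :
    schurQ rows x = limitWick x (ExteriorAlgebra.ιMulti 𝕜 n fun i => siteVec 𝕜 (l i)) := by
  have h1 := tendsto_siteSum x hx l rows h hrows
  have h2 : Filter.Tendsto
      (fun k => siteWick x k (ExteriorAlgebra.ιMulti 𝕜 n fun i => siteVec 𝕜 (l i))) Filter.atTop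
      (nhds (limitWick x (ExteriorAlgebra.ιMulti 𝕜 n fun i => siteVec 𝕜 (l i)))) := by
    refine tendsto_wick (fun k => formOfMatrix (siteMatrix x k)) _ _ _ n _ fun i j => ?_
    simp only [formOfMatrix_siteVec]
    exact tendsto_siteMatrix x hx _ _
  simp only [pfaffianFormula x _ n hn l hl] at h1
  exact tendsto_nhds_unique h1 h2

end Convergence

/-! ### The product defining the `q_k`, and its identification with the one-row functions. -/

section GeneratingFunction

variable {𝕜 : Type*} [RCLike 𝕜]

theorem inv_one_sub_C_mul_X {K : Type*} [Field K] (a : K) :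
    (1 - PowerSeries.C a * PowerSeries.X)⁻¹ = PowerSeries.mk fun n => a ^ n := by
  rw [PowerSeries.inv_eq_iff_mul_eq_one (by simp), mul_sub, mul_one]
  ext n
  rw [map_sub, mul_comm, mul_assoc]
  cases n with
  | zero => simp
  | succ n =>
    rw [PowerSeries.coeff_C_mul, PowerSeries.coeff_succ_X_mul]
    simp [PowerSeries.coeff_one, pow_succ, mul_comm]

/-- The part of positive degree of `qFactor x i`. -/
noncomputable def qTail (x : ℕ → 𝕜) (i : ℕ) : PowerSeries 𝕜 :=
  PowerSeries.mk fun k => if k = 0 then 0 else 2 * x i ^ k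

theorem qFactor_eq (x : ℕ → 𝕜) (i : ℕ) : qFactor x i = 1 + qTail x i := by
  rw [qFactor, inv_one_sub_C_mul_X, qTail]
  ext n
  rw [add_mul, one_mul, mul_assoc, map_add, PowerSeries.coeff_C_mul]
  cases n with
  | zero => simp
  | succ n =>
    rw [PowerSeries.coeff_succ_X_mul]
    simp [PowerSeries.coeff_one]
    ring

theorem sum_antidiagonal_pow_le {a b : ℝ} (ha : 0 ≤ a) (hb : 0 ≤ b) (n : ℕ) :
    ∑ p ∈ Finset.HasAntidiagonal.antidiagonal n, a ^ p.1 * b ^ p.2 ≤ (a + b) ^ n := by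
  rw [(Commute.all a b).add_pow']
  refine Finset.sum_le_sum fun p hp => ?_
  rw [nsmul_eq_mul]
  refine le_mul_of_one_le_left (by positivity) ?_
  have := Finset.HasAntidiagonal.mem_antidiagonal.1 hp
  exact_mod_cast Nat.choose_pos (by omega)

theorem norm_coeff_qTail_mul_le (x : ℕ → 𝕜) (i n : ℕ) (P : PowerSeries 𝕜) :
    ‖PowerSeries.coeff n P‖ + ‖PowerSeries.coeff n (qTail x i * P)‖ ≤
      ∑ p ∈ Finset.HasAntidiagonal.antidiagonal n, (2 * ‖x i‖) ^ p.1 * ‖PowerSeries.coeff p.2 P‖ := by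
  have h0 : (0, n) ∈ Finset.HasAntidiagonal.antidiagonal n := by simp
  have hc : ‖PowerSeries.coeff n (qTail x i * P)‖ ≤
      ∑ p ∈ (Finset.HasAntidiagonal.antidiagonal n).erase (0, n), (2 * ‖x i‖) ^ p.1 * ‖PowerSeries.coeff p.2 P‖ := by
    rw [PowerSeries.coeff_mul, ← Finset.add_sum_erase _ _ h0]
    have : PowerSeries.coeff (0, n).1 (qTail x i) = 0 := by simp [qTail]
    rw [this, zero_mul, zero_add]
    refine norm_sum_le_of_le _ fun p hp => ?_
    rw [norm_mul]
    refine mul_le_mul_of_nonneg_right ?_ (norm_nonneg _)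
    obtain ⟨hp1, hp2⟩ := Finset.mem_erase.1 hp
    have hp0 : p.1 ≠ 0 := by
      rintro h
      apply hp1
      have := Finset.HasAntidiagonal.mem_antidiagonal.1 hp2
      ext <;> simp <;> omega
    rw [qTail, PowerSeries.coeff_mk, if_neg hp0, norm_mul, norm_pow, mul_pow, RCLike.norm_ofNat]
    refine mul_le_mul_of_nonneg_right ?_ (by positivity)
    exact le_self_pow₀ one_le_two hp0
  rw [← Finset.add_sum_erase _ _ h0]
  simp only [pow_zero, one_mul]
  linarith

/-- A new index contributes the factor `1 + qTail x i`, whose coefficient of degree `k` is bounded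
by `(2 ‖x i‖) ^ k`. Convolving with the induction bound gives a binomial sum without its
coefficients, at most the next power. The bound is uniform in `s`, which makes the expanded product
coefficientwise summable. -/
theorem sum_norm_coeff_prod_qTail_le (x : ℕ → 𝕜) (s : Finset ℕ) :
    ∀ n, ∑ t ∈ s.powerset, ‖PowerSeries.coeff n (∏ i ∈ t, qTail x i)‖ ≤
      (∑ i ∈ s, 2 * ‖x i‖) ^ n := by
  induction s using Finset.induction_on with
  | empty =>
    intro n
    rcases n with _ | n <;> simp [PowerSeries.coeff_one]
  | insert i s hi ih =>
    intro n
    rw [Finset.sum_powerset_insert hi, ← Finset.sum_add_distrib, Finset.sum_insert hi]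
    have hb : 0 ≤ ∑ i ∈ s, 2 * ‖x i‖ := Finset.sum_nonneg fun _ _ => by positivity
    refine le_trans ?_ (sum_antidiagonal_pow_le (by positivity) hb n)
    calc ∑ t ∈ s.powerset, (‖PowerSeries.coeff n (∏ i ∈ t, qTail x i)‖ +
          ‖PowerSeries.coeff n (∏ j ∈ insert i t, qTail x j)‖)
        ≤ ∑ t ∈ s.powerset, ∑ p ∈ Finset.HasAntidiagonal.antidiagonal n,
            (2 * ‖x i‖) ^ p.1 * ‖PowerSeries.coeff p.2 (∏ i ∈ t, qTail x i)‖ := by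
          refine Finset.sum_le_sum fun t ht => ?_
          rw [Finset.prod_insert fun h => hi (Finset.mem_powerset.1 ht h)]
          exact norm_coeff_qTail_mul_le x i n _
      _ = ∑ p ∈ Finset.HasAntidiagonal.antidiagonal n, (2 * ‖x i‖) ^ p.1 *
            ∑ t ∈ s.powerset, ‖PowerSeries.coeff p.2 (∏ i ∈ t, qTail x i)‖ := by
          rw [Finset.sum_comm]
          simp only [Finset.mul_sum]
      _ ≤ _ := Finset.sum_le_sum fun p _ => mul_le_mul_of_nonneg_left (ih p.2) (by positivity)

theorem multipliable_qFactor (x : ℕ → 𝕜) (hx : Summable fun i => ‖x i‖) :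
    Multipliable (qFactor x) := by
  have h : qFactor x = (1 + qTail x ·) := funext fun i => qFactor_eq x i
  rw [h]
  refine multipliable_one_add_of_summable_prod ?_
  rw [PowerSeries.WithPiTopology.summable_iff_summable_coeff]
  intro n
  refine Summable.of_norm (summable_of_sum_le (c := (∑' i, 2 * ‖x i‖) ^ n)
    (fun _ => norm_nonneg _) fun F => ?_)
  calc ∑ t ∈ F, ‖PowerSeries.coeff n (∏ i ∈ t, qTail x i)‖
      ≤ ∑ t ∈ (F.sup id).powerset, ‖PowerSeries.coeff n (∏ i ∈ t, qTail x i)‖ :=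
        Finset.sum_le_sum_of_subset_of_nonneg
          (fun t ht => Finset.mem_powerset.2 (Finset.le_sup (f := id) ht))
          fun _ _ _ => norm_nonneg _
    _ ≤ (∑ i ∈ F.sup id, 2 * ‖x i‖) ^ n := sum_norm_coeff_prod_qTail_le x _ n
    _ ≤ _ := by
        refine pow_le_pow_left₀ (Finset.sum_nonneg fun _ _ => by positivity) ?_ n
        exact (hx.mul_left 2).sum_le_tsum _ fun _ _ => by positivity

/-! ### Effect of one letter on the one-row generating function. -/

section Recursion

variable {K : Type*} [Field K]

/-- The generating function of the shapes with one row. -/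
noncomputable def rowSeries (x : ℕ → K) (k : ℕ) : PowerSeries K :=
  PowerSeries.mk fun r => siteMatrix x k (r + 1) 0

theorem rowSeries_zero (x : ℕ → K) : rowSeries x 0 = 1 := by
  ext r
  rw [rowSeries, PowerSeries.coeff_mk, PowerSeries.coeff_one]
  split_ifs with h
  · rw [h, siteMatrix_one_zero]
  · rw [siteMatrix, if_pos (Nat.succ_pos r), siteSum, codedSum_zero _ _ _ 0]
    simpa [siteRows, siteExt] using h

variable [CharZero K]

theorem siteMatrix_succ_even (x : ℕ → K) (m r : ℕ) :
    siteMatrix x (2 * m + 1) (r + 2) 0 =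
      siteMatrix x (2 * m) (r + 2) 0 + x m * siteMatrix x (2 * m) (r + 1) 0 := by
  rw [← formOfMatrix_letterVec x (2 * m) (pfaffianFormula x _) (r + 2) 0 (by omega) (by omega)
    (by omega)]
  simp [letterVec, formOfMatrix_siteVec]

theorem siteMatrix_succ_odd (x : ℕ → K) (m r : ℕ) :
    siteMatrix x (2 * m + 2) (r + 1) 0 =
      ∑ t ∈ Finset.range (r + 1), x m ^ (r - t) * siteMatrix x (2 * m + 1) (t + 1) 0 := by
  rcases r with _ | r
  · simp [siteMatrix_one_zero]
  rw [← formOfMatrix_letterVec x (2 * m + 1) (pfaffianFormula x _) (r + 2) 0 (by omega) (by omega)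
    (by omega)]
  have h : (2 * m + 1) / 2 = m := by omega
  rw [letterVec, if_neg (by omega), if_neg (by omega), letterVec, if_pos rfl, map_sum,
    LinearMap.sum_apply, h]
  refine Finset.sum_nbij' (· - 1) (· + 1) ?_ ?_ ?_ ?_ ?_
  · intro t ht
    rw [Finset.mem_Ioc] at ht
    rw [Finset.mem_range]
    omega
  · intro t ht
    rw [Finset.mem_range] at ht
    rw [Finset.mem_Ioc]
    omega
  · intro t ht
    rw [Finset.mem_Ioc] at ht
    omega
  · intro t _
    omega
  · intro t ht
    rw [Finset.mem_Ioc] at ht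
    rw [map_smul, LinearMap.smul_apply, smul_eq_mul, formOfMatrix_siteVec,
      show t - 1 + 1 = t by omega, show r + 1 - (t - 1) = r + 2 - t by omega]

theorem rowSeries_succ_even (x : ℕ → K) (m : ℕ) :
    rowSeries x (2 * m + 1) = (1 + PowerSeries.C (x m) * PowerSeries.X) * rowSeries x (2 * m) := by
  ext r
  rw [add_mul, one_mul, mul_assoc, map_add, PowerSeries.coeff_C_mul]
  rcases r with _ | r
  · simp [rowSeries, siteMatrix_one_zero]
  · rw [PowerSeries.coeff_succ_X_mul]
    simp only [rowSeries, PowerSeries.coeff_mk]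
    exact siteMatrix_succ_even x m r

theorem rowSeries_succ_odd (x : ℕ → K) (m : ℕ) :
    rowSeries x (2 * m + 2) =
      (1 - PowerSeries.C (x m) * PowerSeries.X)⁻¹ * rowSeries x (2 * m + 1) := by
  ext r
  rw [inv_one_sub_C_mul_X, mul_comm (PowerSeries.mk _), PowerSeries.coeff_mul,
    Finset.Nat.sum_antidiagonal_eq_sum_range_succ_mk]
  simp only [rowSeries, PowerSeries.coeff_mk]
  rw [siteMatrix_succ_odd]
  exact Finset.sum_congr rfl fun t _ => mul_comm _ _

end Recursion

/-- In a single row a marked letter occurs at most once, giving `1 + x t`, and an unmarked letter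
any number of times, giving `1 / (1 - x t)`. -/
theorem rowSeries_eq_prod (x : ℕ → 𝕜) (m : ℕ) :
    rowSeries x (2 * m) = ∏ i ∈ Finset.range m, qFactor x i := by
  induction m with
  | zero => simp [rowSeries_zero]
  | succ m ih =>
    rw [Finset.prod_range_succ, ← ih, show 2 * (m + 1) = 2 * m + 2 by ring, rowSeries_succ_odd,
      rowSeries_succ_even, qFactor]
    ring

theorem qFun_eq_limitMatrix (x : ℕ → 𝕜) (hx : Summable fun i => ‖x i‖) (r : ℕ) :
    qFun r x = limitMatrix x (r + 1) 0 := by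
  have h1 : Filter.Tendsto (fun m => PowerSeries.coeff r (∏ i ∈ Finset.range m, qFactor x i))
      Filter.atTop (nhds (qFun r x)) :=
    ((PowerSeries.WithPiTopology.continuous_coeff 𝕜 r).tendsto _).comp
      (multipliable_qFactor x hx).hasProd.tendsto_prod_nat
  -- The letters with codes below `2 * m` are exactly those of the first `m` variables.
  have h2 : Filter.Tendsto (fun m : ℕ => 2 * m) Filter.atTop Filter.atTop :=
    Filter.tendsto_id.const_mul_atTop' two_pos
  have h3 := (tendsto_siteMatrix x hx (r + 1) 0).comp h2
  refine tendsto_nhds_unique h1 (h3.congr fun m => ?_)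
  rw [← rowSeries_eq_prod, rowSeries, PowerSeries.coeff_mk]
  rfl

end GeneratingFunction

/-! ### The matrix `K_h` as a Gram matrix, and the sum over strict partitions. -/

section Gessel

variable {𝕜 : Type*} [RCLike 𝕜]

/-- The site of the index `i` of the matrix `gesselK`. -/
def siteOf (i : ℕ) : ℕ := if i = 0 then 0 else i + 1

variable (𝕜) in
/-- The normalization of the index `i` of the matrix `gesselK`. -/
noncomputable def gesselScale (i : ℕ) : 𝕜 := if i = 0 then 1 else 1 / ((√2 : ℝ) : 𝕜)

variable (𝕜) in
/-- Vectors whose Gram matrix is `gesselK`. -/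
noncomputable def gesselVec (i : ℕ) : ℕ →₀ 𝕜 := gesselScale 𝕜 i • siteVec 𝕜 (siteOf i)

theorem one_div_sqrt_two_mul_self : (1 / ((√2 : ℝ) : 𝕜)) * (1 / ((√2 : ℝ) : 𝕜)) = 1 / 2 := by
  rw [div_mul_div_comm, ← RCLike.ofReal_mul, Real.mul_self_sqrt zero_le_two,
    RCLike.ofReal_ofNat, one_mul]

theorem gramMatrix_gesselVec (h : ℕ) (x : ℕ → 𝕜) (hx : Summable fun i => ‖x i‖) :
    gramMatrix (formOfMatrix (limitMatrix x)) (fun i : Fin (h + 1) => gesselVec 𝕜 i) =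
      gesselK h x := by
  ext r s
  have hval : ∀ t : Fin (h + 1), (t : ℕ) = 0 ↔ t = 0 := fun t => by rw [Fin.ext_iff]; rfl
  simp only [gramMatrix, gesselVec, Matrix.of_apply, map_smul, LinearMap.smul_apply, smul_eq_mul,
    formOfMatrix_siteVec, gesselK, siteOf, gesselScale, hval]
  split_ifs
  · simp [limitMatrix]
  · rw [← qFun_eq_limitMatrix x hx, one_mul]
  · rw [limitMatrix_neg, ← qFun_eq_limitMatrix x hx]
    ring
  · rw [← one_div_sqrt_two_mul_self, mul_assoc]
    simp [limitMatrix, schurQPair]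

theorem wedgeList_map_smul {R M : Type*} [CommRing R] [AddCommGroup M] [Module R M] (c : ℕ → R)
    (v : ℕ → M) (l : List ℕ) :
    wedgeList R (l.map fun i => c i • v i) = (l.map c).prod • wedgeList R (l.map v) := by
  induction l with
  | nil => simp [wedgeList]
  | cons i l ih =>
    rw [List.map_cons, wedgeList_cons, ih, List.map_cons, List.map_cons, List.prod_cons,
      wedgeList_cons, map_smul, smul_mul_smul_comm]

/-- Schur's formula in the form needed below: `l` is `rows` with each part raised by `1`, possibly
followed by padding sites that stand for empty rows. -/
theorem schurQ_eq_wedgeList (x : ℕ → 𝕜) (hx : Summable fun i => ‖x i‖) (l rows : List ℕ)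
    (hl : l.Pairwise (· > ·)) (heven : Even l.length)
    (h : ∀ i, l.getD i 0 - 1 = rows.getD i 0) (hlen : rows.length ≤ l.length) :
    schurQ rows x = limitWick x (wedgeList 𝕜 (l.map (siteVec 𝕜))) := by
  have h1 : wedgeList 𝕜 (l.map (siteVec 𝕜)) =
      ExteriorAlgebra.ιMulti 𝕜 l.length (fun i => siteVec 𝕜 (l.get i)) := by
    rw [← wedgeList_ofFn]
    conv_lhs => rw [← List.ofFn_get l, List.map_ofFn]
    rfl
  rw [h1]
  refine schurQ_eq_limitWick x hx heven (fun i => l.get i)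
    (fun i j hij => List.pairwise_iff_get.1 hl i j hij) rows ?_ hlen
  funext i
  rw [rowsFun, ← h i, siteRows, siteExt]
  split_ifs with hi
  · simp [hi]
  · rw [List.getD_eq_default _ _ (not_lt.1 hi)]

/-- The Gaussian expectation of the product of the vectors `gesselVec i`, `i ∈ S`. -/
noncomputable def gesselTerm (x : ℕ → 𝕜) (S : Finset ℕ) : 𝕜 :=
  limitWick x (wedgeList 𝕜 ((S.sort (· ≥ ·)).map (gesselVec 𝕜)))

theorem gesselTerm_of_odd (x : ℕ → 𝕜) (S : Finset ℕ) (hS : Odd S.card) : gesselTerm x S = 0 := by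
  rw [gesselTerm, wedgeList_eq_ιMulti, limitWick, wick_ιMulti_odd]
  simpa using hS

theorem gesselTerm_eq (x : ℕ → 𝕜) (S : Finset ℕ) :
    gesselTerm x S = ((S.sort (· ≥ ·)).map (gesselScale 𝕜)).prod *
      limitWick x (wedgeList 𝕜 (((S.sort (· ≥ ·)).map siteOf).map (siteVec 𝕜))) := by
  have h := wedgeList_map_smul (gesselScale 𝕜) (fun i => siteVec 𝕜 (siteOf i)) (S.sort (· ≥ ·))
  rw [gesselTerm, List.map_map]
  change limitWick x (wedgeList 𝕜 ((S.sort (· ≥ ·)).map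
    fun i => gesselScale 𝕜 i • siteVec 𝕜 (siteOf i))) = _
  rw [h, map_smul, smul_eq_mul]
  rfl

theorem siteOf_strictMono : StrictMono siteOf := by
  intro i j hij
  unfold siteOf
  split_ifs <;> omega

theorem map_siteOf_sort_pairwise (S : Finset ℕ) :
    ((S.sort (· ≥ ·)).map siteOf).Pairwise (· > ·) := by
  rw [List.pairwise_map]
  exact ((Finset.pairwise_sort S (· ≥ ·)).and (Finset.sort_nodup S (· ≥ ·))).imp
    fun h => siteOf_strictMono (lt_of_le_of_ne h.1 h.2.symm)

theorem sort_insert_zero {p : Finset ℕ} (hp : 0 ∉ p) :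
    (insert 0 p).sort (· ≥ ·) = p.sort (· ≥ ·) ++ [0] := by
  refine List.Perm.eq_of_pairwise (le := (· ≥ ·)) (fun a b _ _ h h' => le_antisymm h' h)
    (Finset.pairwise_sort _ _) ?_ ?_
  · rw [List.pairwise_append]
    refine ⟨Finset.pairwise_sort _ _, by simp, ?_⟩
    intro a _ b hb
    simp at hb
    omega
  · refine (List.perm_ext_iff_of_nodup (Finset.sort_nodup _ _) ?_).2 fun a => ?_
    · rw [List.nodup_append]
      refine ⟨Finset.sort_nodup _ _, by simp, ?_⟩
      intro a ha b hb
      simp at ha hb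
      rintro rfl
      exact hp (hb ▸ ha)
    · simp [or_comm]

theorem map_scale_sort {p : Finset ℕ} (hp : 0 ∉ p) :
    ((p.sort (· ≥ ·)).map (gesselScale 𝕜)).prod = (1 / ((√2 : ℝ) : 𝕜)) ^ p.card := by
  rw [List.map_congr_left (g := fun _ => 1 / ((√2 : ℝ) : 𝕜))]
  · simp
  · intro a ha
    have : a ≠ 0 := by rintro rfl; exact hp ((Finset.mem_sort _).1 ha)
    simp [gesselScale, this]

theorem getD_map_siteOf {p : Finset ℕ} (hp : 0 ∉ p) (i : ℕ) :
    ((p.sort (· ≥ ·)).map siteOf).getD i 0 - 1 = (p.sort (· ≥ ·)).getD i 0 := by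
  rcases lt_or_ge i (p.sort (· ≥ ·)).length with h | h
  · have h1 : (p.sort (· ≥ ·))[i] ≠ 0 := by
      intro h0
      exact hp ((Finset.mem_sort _).1 (h0 ▸ List.getElem_mem h))
    rw [List.getD_eq_getElem _ _ (by simpa using h), List.getD_eq_getElem _ _ h, List.getElem_map,
      siteOf, if_neg h1]
    simp
  · rw [List.getD_eq_default _ _ (by simpa using h), List.getD_eq_default _ _ h]

theorem gesselTerm_of_even (x : ℕ → 𝕜) (hx : Summable fun i => ‖x i‖) {p : Finset ℕ} (hp : 0 ∉ p)
    (heven : Even p.card) :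
    gesselTerm x p = (1 / ((√2 : ℝ) : 𝕜)) ^ p.card * schurQ (partsDesc p) x := by
  rw [gesselTerm_eq, map_scale_sort hp, ← schurQ_eq_wedgeList x hx _ (partsDesc p)
    (map_siteOf_sort_pairwise p) (by simpa using heven) (getD_map_siteOf hp) (by simp [partsDesc])]

/-- The index `0` adds an empty row at the site `0`, making the number of rows even; its scale is
`1`, so the power of `1/√2` still counts the parts of `p` only. -/
theorem gesselTerm_insert_of_odd (x : ℕ → 𝕜) (hx : Summable fun i => ‖x i‖) {p : Finset ℕ}
    (hp : 0 ∉ p) (hodd : Odd p.card) :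
    gesselTerm x (insert 0 p) = (1 / ((√2 : ℝ) : 𝕜)) ^ p.card * schurQ (partsDesc p) x := by
  rw [gesselTerm_eq, ← schurQ_eq_wedgeList x hx _ (partsDesc p) (map_siteOf_sort_pairwise _)]
  · rw [sort_insert_zero hp, List.map_append, List.prod_append, map_scale_sort hp]
    simp [gesselScale]
  · rw [List.length_map, Finset.length_sort, Finset.card_insert_of_notMem hp]
    exact hodd.add_one
  · intro i
    rw [sort_insert_zero hp, List.map_append, partsDesc, ← getD_map_siteOf hp]
    rcases lt_or_ge i ((p.sort (· ≥ ·)).map siteOf).length with h | h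
    · rw [List.getD_append _ _ _ _ h]
    · rw [List.getD_append_right _ _ _ _ h, List.getD_eq_default (p.sort (· ≥ ·) |>.map siteOf) _ h]
      rcases i - ((p.sort (· ≥ ·)).map siteOf).length with _ | j <;> simp [siteOf]
  · rw [sort_insert_zero hp]
    simp [partsDesc]

/-- The subsets of `{0, …, h}` are paired as `p` and `p ∪ {0}` with `p` a strict partition. Exactly
one member of each pair has even size and contributes; the two normalizations multiply to
`2^{-ℓ(p)}`. -/
theorem gesselSum_eq_sum_gesselTerm (h : ℕ) (x y : ℕ → 𝕜) (hx : Summable fun i => ‖x i‖)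
    (hy : Summable fun i => ‖y i‖) :
    gesselSum h x y =
      ∑ S ∈ (Finset.range (h + 1)).powerset, gesselTerm x S * gesselTerm y S := by
  have h0 : Finset.range (h + 1) = insert 0 (Finset.Icc 1 h) := by
    ext i; simp; omega
  have h1 : (0 : ℕ) ∉ Finset.Icc 1 h := by simp
  rw [h0, Finset.sum_powerset_insert h1, ← Finset.sum_add_distrib, gesselSum, strictPartitions]
  refine Finset.sum_congr rfl fun p hp => ?_
  have hp0 : 0 ∉ p := fun hc => h1 (Finset.mem_powerset.1 hp hc)
  have hpow : ((1 : 𝕜) / ((√2 : ℝ) : 𝕜)) ^ p.card * (1 / ((√2 : ℝ) : 𝕜)) ^ p.card =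
      1 / 2 ^ p.card := by
    rw [← mul_pow, one_div_sqrt_two_mul_self, one_div_pow]
  have hlen : (partsDesc p).length = p.card := by simp [partsDesc]
  have key : schurQ (partsDesc p) x * schurP (partsDesc p) y =
      ((1 / ((√2 : ℝ) : 𝕜)) ^ p.card * schurQ (partsDesc p) x) *
        ((1 / ((√2 : ℝ) : 𝕜)) ^ p.card * schurQ (partsDesc p) y) := by
    rw [mul_mul_mul_comm, hpow, schurP, hlen]
    ring
  rcases Nat.even_or_odd p.card with he | ho
  · rw [gesselTerm_of_even x hx hp0 he, gesselTerm_of_even y hy hp0 he,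
      gesselTerm_of_odd x (insert 0 p) (by
        rw [Finset.card_insert_of_notMem hp0]; exact he.add_one), zero_mul, add_zero, key]
  · rw [gesselTerm_insert_of_odd x hx hp0 ho, gesselTerm_insert_of_odd y hy hp0 ho,
      gesselTerm_of_odd x p ho, zero_mul, zero_add, key]

theorem gesselSum_sq (h : ℕ) (x y : ℕ → 𝕜) (hx : Summable fun i => ‖x i‖)
    (hy : Summable fun i => ‖y i‖) :
    gesselSum h x y ^ 2 = (1 - gesselK h x * gesselK h y).det := by
  rw [gesselSum_eq_sum_gesselTerm h x y hx hy, ← gramMatrix_gesselVec h x hx,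
    ← gramMatrix_gesselVec h y hy]
  exact sum_wick_mul_wick_sq _ _ _ _ (gesselVec 𝕜) (gesselVec 𝕜) (h + 1)

/-! ### Homogeneity and positivity, which select the square root. -/

theorem schurQ_smul (rows : List ℕ) (z : 𝕜) (x : ℕ → 𝕜) :
    schurQ rows (z • x) = z ^ Fintype.card (ShiftedCell rows) * schurQ rows x := by
  rw [schurQ, schurQ, ← tsum_mul_left]
  refine tsum_congr fun T => ?_
  simp [ShiftedTableau.weight, Finset.prod_mul_distrib]

theorem schurQ_nil (x : ℕ → 𝕜) : schurQ [] x = 1 := by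
  have : Subsingleton (ShiftedTableau []) :=
    ⟨fun S T => ShiftedTableau.ext_entry (funext fun c => c.1.elim0)⟩
  let T : ShiftedTableau [] :=
    { entry := fun c => c.1.elim0
      row_weak := fun c => c.1.elim0
      col_weak := fun c => c.1.elim0
      row_marked := fun c => c.1.elim0
      col_unmarked := fun c => c.1.elim0 }
  have : Unique (ShiftedTableau []) := ⟨⟨T⟩, fun S => Subsingleton.elim _ _⟩
  rw [schurQ, tsum_fintype, Fintype.sum_unique]
  exact Finset.prod_eq_one fun c => c.1.elim0

theorem card_shiftedCell_pos {p : Finset ℕ} (hp : 0 ∉ p) (hne : p ≠ ∅) :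
    Fintype.card (ShiftedCell (partsDesc p)) ≠ 0 := by
  have hlen : 0 < (partsDesc p).length := by
    simpa [partsDesc, Finset.card_pos, Finset.nonempty_iff_ne_empty] using hne
  have h0 : (partsDesc p).get ⟨0, hlen⟩ ≠ 0 := fun h =>
    hp ((Finset.mem_sort _).1 (h ▸ List.get_mem (partsDesc p) ⟨0, hlen⟩))
  have : Nonempty (ShiftedCell (partsDesc p)) :=
    ⟨⟨⟨0, hlen⟩, ⟨0, Nat.pos_of_ne_zero h0⟩⟩⟩
  exact Fintype.card_ne_zero

theorem gesselSum_smul_zero (h : ℕ) (x y : ℕ → 𝕜) :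
    gesselSum h ((0 : 𝕜) • x) ((0 : 𝕜) • y) = 1 := by
  rw [gesselSum, Finset.sum_eq_single ∅]
  · simp [partsDesc, schurP, schurQ_nil]
  · intro p hp hne
    have hp0 : 0 ∉ p := fun hc => by simpa using Finset.mem_powerset.1 hp hc
    rw [schurQ_smul, zero_pow (card_shiftedCell_pos hp0 hne), zero_mul, zero_mul]
  · simp [strictPartitions]

/-- By homogeneity of the `Q_λ` the function is a polynomial in `z`. -/
theorem analyticOnNhd_gesselSum_smul (h : ℕ) (x y : ℕ → 𝕜) :
    AnalyticOnNhd 𝕜 (fun z : 𝕜 => gesselSum h (z • x) (z • y)) Set.univ := by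
  simp only [gesselSum, schurP, schurQ_smul]
  refine Finset.analyticOnNhd_fun_sum _ fun p _ z _ => ?_
  fun_prop

theorem schurQ_nonneg (rows : List ℕ) (x : ℕ → 𝕜) (hx : Summable fun i => ‖x i‖)
    (h : ∀ i, 0 ≤ x i) : 0 ≤ schurQ rows x := by
  refine ge_of_tendsto' (summable_weight x hx rows).hasSum fun s => ?_
  exact Finset.sum_nonneg fun T _ => Finset.prod_nonneg fun c _ => h _

theorem gesselSum_nonneg (h : ℕ) (x y : ℕ → 𝕜) (hx : Summable fun i => ‖x i‖)
    (hy : Summable fun i => ‖y i‖) (hx0 : ∀ i, 0 ≤ x i) (hy0 : ∀ i, 0 ≤ y i) :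
    0 ≤ gesselSum h x y := by
  refine Finset.sum_nonneg fun p _ => mul_nonneg (schurQ_nonneg _ x hx hx0) ?_
  rw [schurP, div_eq_mul_inv]
  refine mul_nonneg (schurQ_nonneg _ y hy hy0) ?_
  have : ((2 : 𝕜) ^ (partsDesc p).length)⁻¹ = (((2 : ℝ) ^ (partsDesc p).length)⁻¹ : ℝ) := by
    rw [RCLike.ofReal_inv, RCLike.ofReal_pow, RCLike.ofReal_ofNat]
  rw [this, RCLike.ofReal_nonneg]
  positivity

theorem eq_sqrt_re_of_sq_eq {g d : 𝕜} (hg : 0 ≤ g) (h : g ^ 2 = d) :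
    g = ((√(RCLike.re d) : ℝ) : 𝕜) := by
  obtain ⟨h1, h2⟩ := RCLike.nonneg_iff.1 hg
  have hr : g = (RCLike.re g : 𝕜) := by
    rw [← RCLike.re_add_im g, h2]; simp
  rw [← h, hr, ← RCLike.ofReal_pow, RCLike.ofReal_re, Real.sqrt_sq h1]

end Gessel

theorem mainTheorem2 {𝕜 : Type*} [RCLike 𝕜] (h : ℕ) (x y : ℕ → 𝕜)
    (hx : Summable fun i => ‖x i‖) (hy : Summable fun i => ‖y i‖) :
    -- the series and products that define the two sides converge
    ((∀ rows : List ℕ, Summable fun T : ShiftedTableau rows => T.weight x) ∧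
      (∀ rows : List ℕ, Summable fun T : ShiftedTableau rows => T.weight y) ∧
      Multipliable (qFactor x) ∧ Multipliable (qFactor y)) ∧
    -- the partition sum is a square root of the determinant
    gesselSum h x y ^ 2 = (1 - gesselK h x * gesselK h y).det ∧
    -- it is the value at `z = 1` of the analytic branch, equal to `1` at `z = 0`, of the square
    -- root of the determinant for the parameters `z x`, `z y`
    (∃ f : 𝕜 → 𝕜, AnalyticOnNhd 𝕜 f Set.univ ∧ f 0 = 1 ∧
      (∀ z : 𝕜, f z ^ 2 = (1 - gesselK h (z • x) * gesselK h (z • y)).det) ∧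
      gesselSum h x y = f 1) ∧
    -- for nonnegative parameters it is the nonnegative square root
    ((∀ i, 0 ≤ x i) → (∀ i, 0 ≤ y i) →
      gesselSum h x y = ((√(RCLike.re (1 - gesselK h x * gesselK h y).det) : ℝ) : 𝕜)) := by
  refine ⟨⟨fun rows => summable_weight x hx rows, fun rows => summable_weight y hy rows,
    multipliable_qFactor x hx, multipliable_qFactor y hy⟩, gesselSum_sq h x y hx hy, ?_, ?_⟩
  · refine ⟨fun z => gesselSum h (z • x) (z • y), analyticOnNhd_gesselSum_smul h x y,
      gesselSum_smul_zero h x y, fun z => ?_, by simp only [one_smul]⟩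
    refine gesselSum_sq h _ _ ?_ ?_
    · simpa [norm_mul] using hx.mul_left ‖z‖
    · simpa [norm_mul] using hy.mul_left ‖z‖
  · intro hx0 hy0
    exact eq_sqrt_re_of_sq_eq (gesselSum_nonneg h x y hx hy hx0 hy0) (gesselSum_sq h x y hx hy)
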